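/- Let $\mathfrak g$ be a finite-dimensional complex semisimple Lie algebra with Cartan subalgebra $\mathfrak h$, root system $\Delta\subset\mathfrak h^*$, simple roots $\alpha_1,\dots,\alpha_N$, and let $(\cdot,\cdot)$ be a Weyl-group-invariant symmetric complex bilinear form on $\mathfrak h^*$ that is real-valued on pairs of roots with $(\alpha,\alpha)>0$ for every root $\alpha$ (for instance, the Killing form rescaled so that the shortest root $\alpha$ satisfies $(\alpha,\alpha)=2$). Put $\alpha_j^\vee=2\alpha_j/(\alpha_j,\alpha_j)$, $d_i=(\alpha_i,\alpha_i)/2$, $a_{ij}=(\alpha_i^\vee,\alpha_j)$, $\mathbf P=\{\mu\in\mathfrak h^*: (\mu,\alpha_j^\vee)\in\mathbb Z \text{ for all } j\}$ and $\mathbf Q^\vee=\bigoplus_j\mathbb Z\alpha_j^\vee$. Let $h\in\mathbb R^\times$, $q=e^h$, $q_i=q^{d_i}$, $\hbar=h/2\pi$. Let $U_q(\mathfrak g)$ be the $\mathbb C$-algebra with generators $K_\lambda$ ($\lambda\in\mathbf P$), $E_i,F_i$ ($1\le i\le N$) and relations $$K_0=1,\quad K_\lambda K_\mu=K_{\lambda+\mu},\quad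 K_\lambda E_jK_\lambda^{-1}=q^{(\lambda,\alpha_j)}E_j,\quad K_\lambda F_jK_\lambda^{-1}=q^{-(\lambda,\alpha_j)}F_j,\quad [E_i,F_j]=\delta_{ij}\frac{K_{\alpha_i}-K_{\alpha_i}^{-1}}{q_i-q_i^{-1}},$$ $$\sum_{k=0}^{1-a_{ij}}(-1)^k\begin{bmatrix}1-a_{ij}\\k\end{bmatrix}_{q_i}X_i^{1-a_{ij}-k}X_jX_i^k=0\qquad(i\ne j,\ X=E \text{ or } X=F),$$ with the comultiplication $K_\lambda\mapsto K_\lambda\otimes K_\lambda$, $E_i\mapsto E_i\otimes K_{\alpha_i}+1\otimes E_i$, $F_i\mapsto F_i\otimes1+K_{\alpha_i}^{-1}\otimes F_i$, through which $U_q(\mathfrak g)$ acts on tensor products over $\mathbb C$ of left modules. Let $\mathfrak h_q^*=\mathfrak h^*/i\hbar^{-1}\mathbf Q^\vee$; a vector $v$ of a left $U_q(\mathfrak g)$-module has weight $\lambda\in\mathfrak h_q^*$ if $K_\mu v=q^{(\lambda,\mu)}v$ for all $\mu\in\mathbf P$. The category $\mathcal O$ consists of the left $U_q(\mathfrak g)$-modules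 $M$ that are finitely generated, are the direct sum of their weight spaces $M_\lambda$ ($\lambda\in\mathfrak h_q^*$), and satisfy $\dim_{\mathbb C}U_q(\mathfrak n_+)v<\infty$ for every $v\in M$, where $U_q(\mathfrak n_+)$ is the subalgebra generated by the $E_i$. For $\lambda\in\mathfrak h_q^*$ let $M(\lambda)=U_q(\mathfrak g)\otimes_{U_q(\mathfrak b_+)}\mathbb C_\lambda$ be the Verma module, where $U_q(\mathfrak b_+)$ is the subalgebra generated by all $E_i$ and $K_\mu$, and on the one-dimensional module $\mathbb C_\lambda$ every $E_i$ acts by $0$ and $K_\mu$ by $q^{(\lambda,\mu)}$. Equivalently, $M(\lambda)$ is the quotient of $U_q(\mathfrak g)$ by the left ideal generated by all $E_i$ and all $K_\mu-q^{(\lambda,\mu)}$. Let $V(\lambda)$ be the quotient of $M(\lambda)$ by the sum of all submodules that do not contain the highest weight vector; it is the simple highest weight module of highest weight $\lambda$. **Lemma.** Let $\mu,\lambda\in\mathfrak h_q^*$ and suppose that $V(\mu)$ is infinite-dimensional over $\mathbb C$. Then $V(\mu)\otimes M(\lambda)\cong M(\lambda)\otimes V(\mu)$ as $U_q(\mathfrak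 g)$-modules, and neither of these modules belongs to $\mathcal O$. -/

import Mathlib

open scoped TensorProduct

noncomputable section

namespace QuantumCatO

/-! ### Quantum integers, binomial coefficients and the quantum Serre expression -/

section QNumbers

/-- The quantum integer `[n]_q = (q ^ n - q ^ (-n)) / (q - q ^ (-1))`. -/
def qInt (q : ℂ) (n : ℕ) : ℂ := (q ^ n - q⁻¹ ^ n) / (q - q⁻¹)

/-- The quantum factorial `[n]_q! = [1]_q [2]_q ⋯ [n]_q`. -/
def qFact (q : ℂ) (n : ℕ) : ℂ := ∏ k ∈ Finset.range n, qInt q (k + 1)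

/-- The quantum binomial coefficient `[n]_q! / ([k]_q! [n - k]_q!)`, for `k ≤ n`. -/
def qBinom (q : ℂ) (n k : ℕ) : ℂ :=
  if k ≤ n then qFact q n / (qFact q k * qFact q (n - k)) else 0

/-- The quantum Serre expression
`∑_{k = 0}^n (-1)^k [n choose k]_q x ^ (n - k) y x ^ k`. -/
def qSerre {A : Type*} [Ring A] [Algebra ℂ A] (q : ℂ) (n : ℕ) (x y : A) : A :=
  ∑ k ∈ Finset.range (n + 1), ((-1) ^ k * qBinom q n k) • (x ^ (n - k) * y * x ^ k)

lemma qInt_inv (q : ℂ) (n : ℕ) : qInt q⁻¹ n = qInt q n := by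
  unfold qInt
  rw [inv_inv, ← neg_sub (q ^ n), ← neg_sub q, neg_div_neg_eq]

lemma qBinom_inv (q : ℂ) (n k : ℕ) : qBinom q⁻¹ n k = qBinom q n k := by
  simp only [qBinom, qFact, qInt_inv]

lemma qSerre_inv {A : Type*} [Ring A] [Algebra ℂ A] (q : ℂ) (n : ℕ) (x y : A) :
    qSerre q⁻¹ n x y = qSerre q n x y := by
  simp only [qSerre, qBinom_inv]

lemma qFact_ne_zero {q : ℂ} (hq : ∀ m, qInt q (m + 1) ≠ 0) (n : ℕ) : qFact q n ≠ 0 :=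
  Finset.prod_ne_zero_iff.mpr fun k _ => hq k

lemma qFact_succ (q : ℂ) (n : ℕ) : qFact q (n + 1) = qFact q n * qInt q (n + 1) :=
  Finset.prod_range_succ _ _

lemma qBinom_zero {q : ℂ} (hq : ∀ m, qInt q (m + 1) ≠ 0) (n : ℕ) : qBinom q n 0 = 1 := by
  have h0 : qFact q 0 = 1 := by simp [qFact]
  simp [qBinom, h0, qFact_ne_zero hq n]

lemma qBinom_succ_self (q : ℂ) (n : ℕ) : qBinom q n (n + 1) = 0 := by
  simp [qBinom]

lemma qInt_add {q : ℂ} (h0 : q ≠ 0) (m k : ℕ) :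
    q ^ k * qInt q (m + k) = qInt q m + q ^ (m + k) * qInt q k := by
  unfold qInt
  rw [← mul_div_assoc, ← mul_div_assoc, ← add_div]
  congr 1
  have hX : q ^ k * q⁻¹ ^ k = 1 := by rw [← mul_pow, mul_inv_cancel₀ h0, one_pow]
  rw [pow_add, pow_add]
  linear_combination (q ^ m - q⁻¹ ^ m) * hX

/-- The quantum Pascal rule. -/
lemma qBinom_succ_succ {q : ℂ} (h0 : q ≠ 0) (hq : ∀ m, qInt q (m + 1) ≠ 0) {n k : ℕ}
    (hk : k ≤ n) :
    q ^ (k + 1) * qBinom q (n + 1) (k + 1) = qBinom q n (k + 1) + q ^ (n + 1) * qBinom q n k := by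
  rcases hk.eq_or_lt with rfl | hk
  · have h0 : qFact q 0 = 1 := by simp [qFact]
    simp [qBinom, h0, qFact_ne_zero hq]
  · obtain ⟨m, rfl⟩ : ∃ m, n = m + 1 + k := ⟨n - k - 1, by omega⟩
    have e1 : m + 1 + k + 1 - (k + 1) = m + 1 := by omega
    have e2 : m + 1 + k - (k + 1) = m := by omega
    have e3 : m + 1 + k - k = m + 1 := by omega
    have hf := qFact_ne_zero hq
    rw [qBinom, if_pos (by omega), qBinom, if_pos (by omega), qBinom, if_pos (by omega), e1, e2, e3,
      qFact_succ q (m + 1 + k), qFact_succ q k, qFact_succ q m]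
    generalize qFact q (m + 1 + k) = X
    have key := qInt_add h0 (m + 1) (k + 1)
    have a1 := hf m
    have a2 := hf k
    have a3 := hq m
    have a4 := hq k
    have e4 : m + 1 + (k + 1) = m + 1 + k + 1 := by omega
    rw [e4] at key
    field_simp
    linear_combination X * key

/-- Iterated `q`-commutators `z_{m+1} = x z_m - c_m z_m x`. -/
def qIter {A : Type*} [Ring A] [Algebra ℂ A] (c : ℕ → ℂ) (x y : A) : ℕ → A
  | 0 => y
  | m + 1 => x * qIter c x y m - c m • (qIter c x y m * x)

lemma qIter_eq_sum {A : Type*} [Ring A] [Algebra ℂ A] {q : ℂ} (h0 : q ≠ 0)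
    (hq : ∀ m, qInt q (m + 1) ≠ 0) (s : ℂ) (x y : A) (m : ℕ) :
    qIter (fun k => s * q ^ (2 * k)) x y (m + 1) =
      ∑ k ∈ Finset.range (m + 2),
        ((-1) ^ k * (s * q ^ m) ^ k * qBinom q (m + 1) k) • (x ^ (m + 1 - k) * y * x ^ k) := by
  have h1 : ∀ k, qBinom q k k = 1 := fun k => by
    have h0 : qFact q 0 = 1 := by simp [qFact]
    simp [qBinom, h0, qFact_ne_zero hq]
  -- normalise the exponent of `q` by multiplying `s` with a power of `q⁻¹`
  suffices H : ∀ m, qIter (fun k => s * q ^ (2 * k)) x y m =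
      ∑ k ∈ Finset.range (m + 1),
        ((-1) ^ k * (s * q⁻¹ * q ^ m) ^ k * qBinom q m k) • (x ^ (m - k) * y * x ^ k) by
    rw [H (m + 1)]
    refine Finset.sum_congr rfl fun k _ => ?_
    congr 4
    field_simp
    ring
  intro m
  induction m with
  | zero => simp [qIter, h1]
  | succ m ih =>
    rw [qIter, ih, Finset.mul_sum, Finset.sum_mul, Finset.smul_sum]
    rw [Finset.sum_range_succ' _ (m + 1)]
    have hA : ∑ k ∈ Finset.range (m + 1),
        x * ((-1) ^ k * (s * q⁻¹ * q ^ m) ^ k * qBinom q m k) • (x ^ (m - k) * y * x ^ k)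
        = ∑ k ∈ Finset.range (m + 1 + 1),
          ((-1) ^ k * (s * q⁻¹ * q ^ m) ^ k * qBinom q m k) • (x ^ (m + 1 - k) * y * x ^ k) := by
      rw [Finset.sum_range_succ _ (m + 1), qBinom_succ_self, mul_zero, zero_smul, add_zero]
      refine Finset.sum_congr rfl fun k hk => ?_
      have : k ≤ m := by simpa [Nat.lt_succ_iff] using hk
      rw [mul_smul_comm, Nat.succ_sub this, pow_succ']
      simp only [mul_assoc]
    rw [hA, Finset.sum_range_succ' _ (m + 1), add_sub_right_comm, ← Finset.sum_sub_distrib]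
    congr 1
    · refine Finset.sum_congr rfl fun k hk => ?_
      have hk : k ≤ m := by simpa [Nat.lt_succ_iff] using hk
      rw [Nat.succ_sub_succ, smul_mul_assoc, smul_smul, mul_assoc (x ^ (m - k) * y), ← pow_succ,
        ← sub_smul]
      congr 1
      have hp := qBinom_succ_succ h0 hq hk
      have e : (s * q⁻¹ * q ^ (m + 1)) ^ (k + 1) =
          (s * q⁻¹ * q ^ m) ^ (k + 1) * q ^ (k + 1) := by
        rw [← mul_pow, pow_succ q m, mul_assoc (s * q⁻¹)]
      have e2 : (s * q⁻¹ * q ^ m) ^ (k + 1) * q ^ (m + 1) =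
          s * q ^ (2 * m) * (s * q⁻¹ * q ^ m) ^ k := by
        rw [pow_succ]
        field_simp
        ring
      rw [e]
      linear_combination (-(-1) ^ (k + 1) * (s * q⁻¹ * q ^ m) ^ (k + 1)) * hp +
        (-1) ^ k * qBinom q m k * e2
    · simp [qBinom_zero hq]

lemma qSerre_eq_qIter {A : Type*} [Ring A] [Algebra ℂ A] {q : ℂ} (h0 : q ≠ 0)
    (hq : ∀ m, qInt q (m + 1) ≠ 0) (x y : A) (m : ℕ) :
    qSerre q (m + 1) x y = qIter (fun k => q⁻¹ ^ m * q ^ (2 * k)) x y (m + 1) := by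
  rw [qIter_eq_sum h0 hq, qSerre]
  refine Finset.sum_congr rfl fun k _ => ?_
  rw [← mul_pow q⁻¹, inv_mul_cancel₀ h0, one_pow, one_pow, mul_one]

lemma qIter_comm {A : Type*} [Ring A] [Algebra ℂ A] {s r : ℂ} {u w y : A}
    (hy : w * y = s • (y * w)) (hu : w * u = r • (u * w)) (c : ℕ → ℂ) (m : ℕ) :
    w * qIter c u y m = (s * r ^ m) • (qIter c u y m * w) := by
  induction m with
  | zero => simpa [qIter] using hy
  | succ m ih =>
    have e1 : w * (u * qIter c u y m) = (s * r ^ (m + 1)) • (u * qIter c u y m * w) := by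
      rw [← mul_assoc, hu, smul_mul_assoc, mul_assoc, ih, mul_smul_comm, smul_smul, mul_assoc u]
      congr 1
      ring
    have e2 : w * (qIter c u y m * u) = (s * r ^ (m + 1)) • (qIter c u y m * u * w) := by
      rw [← mul_assoc, ih, smul_mul_assoc, mul_assoc, hu, mul_smul_comm, smul_smul, ← mul_assoc]
      congr 1
      ring
    rw [qIter, mul_sub, mul_smul_comm, e1, e2, sub_mul, smul_sub, smul_mul_assoc]
    congr 1
    rw [smul_comm]

lemma qIter_add {A : Type*} [Ring A] [Algebra ℂ A] {s r : ℂ} {u w y : A}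
    (hy : w * y = s • (y * w)) (hu : w * u = r • (u * w)) (m : ℕ) :
    qIter (fun k => s * r ^ k) (u + w) y m = qIter (fun k => s * r ^ k) u y m := by
  induction m with
  | zero => rfl
  | succ m ih =>
    rw [qIter, ih, qIter, add_mul, mul_add, smul_add, qIter_comm hy hu]
    abel

lemma qSerre_add_left {A : Type*} [Ring A] [Algebra ℂ A] {q : ℂ} (h0 : q ≠ 0)
    (hq : ∀ m, qInt q (m + 1) ≠ 0) {u w y : A} {m : ℕ}
    (hy : w * y = (q⁻¹ ^ m) • (y * w)) (hu : w * u = (q ^ 2) • (u * w)) :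
    qSerre q (m + 1) (u + w) y = qSerre q (m + 1) u y := by
  rw [qSerre_eq_qIter h0 hq, qSerre_eq_qIter h0 hq]
  simpa only [pow_mul] using qIter_add hy hu (m + 1)

lemma qSerre_add_right {A : Type*} [Ring A] [Algebra ℂ A] (q : ℂ) (n : ℕ) (x y y' : A) :
    qSerre q n x (y + y') = qSerre q n x y + qSerre q n x y' := by
  simp only [qSerre, mul_add, add_mul, smul_add, Finset.sum_add_distrib]

/-- Compatibility of the quantum Serre expression with the two summands of a coproduct. -/
lemma qSerre_coproduct {A : Type*} [Ring A] [Algebra ℂ A] {q : ℂ} (h0 : q ≠ 0)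
    (hq : ∀ m, qInt q (m + 1) ≠ 0) {x₁ x₂ y₁ y₂ : A} {m : ℕ}
    (hxx : x₁ * x₂ = (q ^ 2) • (x₂ * x₁))
    (h₁₂ : x₁ * y₂ = (q⁻¹ ^ m) • (y₂ * x₁)) (h₂₁ : x₂ * y₁ = (q ^ m) • (y₁ * x₂))
    (h₁ : qSerre q (m + 1) x₁ y₁ = 0) (h₂ : qSerre q (m + 1) x₂ y₂ = 0) :
    qSerre q (m + 1) (x₁ + x₂) (y₁ + y₂) = 0 := by
  rw [qSerre_add_right]
  have hB : qSerre q (m + 1) (x₁ + x₂) y₂ = 0 := by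
    rw [add_comm x₁, qSerre_add_left h0 hq h₁₂ hxx, h₂]
  have hA : qSerre q (m + 1) (x₁ + x₂) y₁ = 0 := by
    have hq' : ∀ m, qInt q⁻¹ (m + 1) ≠ 0 := fun m => by rw [qInt_inv]; exact hq m
    rw [← qSerre_inv, qSerre_add_left (inv_ne_zero h0) hq' (m := m) (by rw [inv_inv]; exact h₂₁),
      qSerre_inv, h₁]
    rw [hxx, smul_smul, ← mul_pow, inv_mul_cancel₀ h0, one_pow, one_smul]
  rw [hA, hB, add_zero]

lemma qSerre_tmul_left {A : Type*} [Ring A] [Algebra ℂ A] (q : ℂ) (n : ℕ) (x y k l : A)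
    (hkl : k * l = l * k) :
    qSerre q n (x ⊗ₜ[ℂ] k) (y ⊗ₜ[ℂ] l) = qSerre q n x y ⊗ₜ[ℂ] (l * k ^ n) := by
  simp only [qSerre, TensorProduct.sum_tmul]
  refine Finset.sum_congr rfl fun j hj => ?_
  have hj : j ≤ n := by simpa [Nat.lt_succ_iff] using hj
  rw [Algebra.TensorProduct.tmul_pow, Algebra.TensorProduct.tmul_pow,
    Algebra.TensorProduct.tmul_mul_tmul, Algebra.TensorProduct.tmul_mul_tmul,
    TensorProduct.smul_tmul']
  congr 1
  have hc : Commute (k ^ (n - j)) l := Commute.pow_left hkl _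
  rw [hc.eq, mul_assoc, ← pow_add, Nat.sub_add_cancel hj]

lemma qSerre_tmul_right {A : Type*} [Ring A] [Algebra ℂ A] (q : ℂ) (n : ℕ) (x y k l : A)
    (hkl : k * l = l * k) :
    qSerre q n (k ⊗ₜ[ℂ] x) (l ⊗ₜ[ℂ] y) = (l * k ^ n) ⊗ₜ[ℂ] qSerre q n x y := by
  simp only [qSerre, TensorProduct.tmul_sum]
  refine Finset.sum_congr rfl fun j hj => ?_
  have hj : j ≤ n := by simpa [Nat.lt_succ_iff] using hj
  rw [Algebra.TensorProduct.tmul_pow, Algebra.TensorProduct.tmul_pow,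
    Algebra.TensorProduct.tmul_mul_tmul, Algebra.TensorProduct.tmul_mul_tmul,
    TensorProduct.tmul_smul]
  congr 2
  have hc : Commute (k ^ (n - j)) l := Commute.pow_left hkl _
  rw [hc.eq, mul_assoc, ← pow_add, Nat.sub_add_cancel hj]

lemma map_qSerre {A A' : Type*} [Ring A] [Algebra ℂ A] [Ring A'] [Algebra ℂ A'] (f : A →ₐ[ℂ] A')
    (q : ℂ) (n : ℕ) (x y : A) : f (qSerre q n x y) = qSerre q n (f x) (f y) := by
  simp [qSerre]

end QNumbers

/-! ### The quantized universal enveloping algebra -/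

section Algebra

variable {ι M N : Type*} [AddCommGroup M] [Module ℂ M] [AddCommGroup N] [Module ℂ N]
  {P : RootPairing ι ℂ M N} [P.IsCrystallographic]

/-- The Cartan integers are real numbers. -/
instance isValuedInReal (P : RootPairing ι ℂ M N) [P.IsCrystallographic] : P.IsValuedIn ℝ where
  exists_value i j := ⟨(P.pairingIn ℤ i j : ℤ), by
    have h : ((P.pairingIn ℤ i j : ℤ) : ℂ) = P.pairing i j := P.algebraMap_pairingIn ℤ i j
    simpa using h⟩

/-- The coroot `α_j^∨ = 2 α_j / (α_j, α_j)` of a simple root, as an element of the space of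
weights. -/
def simpleCoroot (B : P.RootPositiveForm ℝ) (b : P.Base) (j : b.support) : M :=
  (2 / B.form (P.root j) (P.root j)) • P.root j

/-- The weight lattice: all `μ` with `(μ, α_j^∨) ∈ ℤ` for all simple roots `α_j`. -/
def weightLattice (B : P.RootPositiveForm ℝ) (b : P.Base) : AddSubgroup M where
  carrier := {μ | ∀ j : b.support, ∃ n : ℤ, B.form μ (simpleCoroot B b j) = n}
  zero_mem' := fun j => ⟨0, by simp⟩
  add_mem' := fun {x y} hx hy j => by
    obtain ⟨m, hm⟩ := hx j
    obtain ⟨n, hn⟩ := hy j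
    exact ⟨m + n, by simp [hm, hn]⟩
  neg_mem' := fun {x} hx j => by
    obtain ⟨m, hm⟩ := hx j
    exact ⟨-m, by simp [hm]⟩

lemma simpleRoot_mem_weightLattice (B : P.RootPositiveForm ℝ) (b : P.Base) (i : b.support) :
    P.root i ∈ weightLattice B b := by
  intro j
  refine ⟨P.pairingIn ℤ i j, ?_⟩
  have h1 := B.two_mul_apply_root_root i j
  have h2 := B.form_apply_root_ne_zero j
  have h3 : ((P.pairingIn ℤ i j : ℤ) : ℂ) = P.pairing i j := P.algebraMap_pairingIn ℤ i j
  rw [simpleCoroot, map_smul, smul_eq_mul, h3]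
  field_simp
  rw [h1, mul_comm]

/-- The simple root `α_i` as an element of the weight lattice. -/
def simpleRoot (B : P.RootPositiveForm ℝ) (b : P.Base) (i : b.support) : weightLattice B b :=
  ⟨P.root i, simpleRoot_mem_weightLattice B b i⟩

/-- `q ^ (λ, μ)` for `q = e ^ h`. -/
def qForm (B : P.RootPositiveForm ℝ) (h : ℝˣ) (l m : M) : ℂ :=
  Complex.exp (((h : ℝ) : ℂ) * B.form l m)

/-- `q_i = q ^ d_i`, where `d_i = (α_i, α_i) / 2`. -/
def qRoot (B : P.RootPositiveForm ℝ) (b : P.Base) (h : ℝˣ) (i : b.support) : ℂ :=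
  Complex.exp (((h : ℝ) : ℂ) * (B.form (P.root i) (P.root i) / 2))

/-- The exponent `1 - a_{ij}` of the quantum Serre relations, where
`a_{ij} = (α_i^∨, α_j) = 2 (α_i, α_j) / (α_i, α_i)`.
Mathlib's convention is `b.cartanMatrix j i = ⟨α_j, α_i^∨⟩`. -/
def serreExp (b : P.Base) (i j : b.support) : ℕ := (1 - b.cartanMatrix j i).toNat

/-- The generators of the quantized universal enveloping algebra. -/
inductive Gen (B : P.RootPositiveForm ℝ) (b : P.Base)
  | K (μ : weightLattice B b)
  | E (i : b.support)
  | F (i : b.support)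

/-- The free algebra on the generators. -/
abbrev FreeUq (B : P.RootPositiveForm ℝ) (b : P.Base) := FreeAlgebra ℂ (Gen B b)

/-- The generator `K_μ` of the free algebra. -/
def fK (B : P.RootPositiveForm ℝ) (b : P.Base) (μ : weightLattice B b) : FreeUq B b :=
  FreeAlgebra.ι ℂ (Gen.K μ)

/-- The generator `E_i` of the free algebra. -/
def fE (B : P.RootPositiveForm ℝ) (b : P.Base) (i : b.support) : FreeUq B b :=
  FreeAlgebra.ι ℂ (Gen.E i)

/-- The generator `F_i` of the free algebra. -/
def fF (B : P.RootPositiveForm ℝ) (b : P.Base) (i : b.support) : FreeUq B b :=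
  FreeAlgebra.ι ℂ (Gen.F i)

/-- The defining relations of the quantized universal enveloping algebra. -/
inductive Rel (B : P.RootPositiveForm ℝ) (b : P.Base) (h : ℝˣ) : FreeUq B b → FreeUq B b → Prop
  | K_zero : Rel B b h (fK B b 0) 1
  | K_mul (l m : weightLattice B b) : Rel B b h (fK B b l * fK B b m) (fK B b (l + m))
  | K_E (l : weightLattice B b) (j : b.support) :
      Rel B b h (fK B b l * fE B b j * fK B b (-l)) (qForm B h l (P.root j) • fE B b j)
  | K_F (l : weightLattice B b) (j : b.support) :
      Rel B b h (fK B b l * fF B b j * fK B b (-l)) ((qForm B h l (P.root j))⁻¹ • fF B b j)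
  | E_F_self (i : b.support) :
      Rel B b h (fE B b i * fF B b i - fF B b i * fE B b i)
        ((qRoot B b h i - (qRoot B b h i)⁻¹)⁻¹ •
          (fK B b (simpleRoot B b i) - fK B b (-simpleRoot B b i)))
  | E_F_ne (i j : b.support) (hij : i ≠ j) :
      Rel B b h (fE B b i * fF B b j - fF B b j * fE B b i) 0
  | serre_E (i j : b.support) (hij : i ≠ j) :
      Rel B b h (qSerre (qRoot B b h i) (serreExp b i j) (fE B b i) (fE B b j)) 0
  | serre_F (i j : b.support) (hij : i ≠ j) :
      Rel B b h (qSerre (qRoot B b h i) (serreExp b i j) (fF B b i) (fF B b j)) 0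

/-- The quantized universal enveloping algebra `U_q(𝔤)`, `q = e ^ h`. -/
def Uq (B : P.RootPositiveForm ℝ) (b : P.Base) (h : ℝˣ) : Type _ := RingQuot (Rel B b h)

instance (B : P.RootPositiveForm ℝ) (b : P.Base) (h : ℝˣ) : Ring (Uq B b h) :=
  inferInstanceAs (Ring (RingQuot (Rel B b h)))

instance (B : P.RootPositiveForm ℝ) (b : P.Base) (h : ℝˣ) : Algebra ℂ (Uq B b h) :=
  inferInstanceAs (Algebra ℂ (RingQuot (Rel B b h)))

namespace Uq

variable (B : P.RootPositiveForm ℝ) (b : P.Base) (h : ℝˣ)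

/-- The projection from the free algebra. -/
def mk : FreeUq B b →ₐ[ℂ] Uq B b h := RingQuot.mkAlgHom ℂ (Rel B b h)

/-- The generator `K_μ`. -/
def K (μ : weightLattice B b) : Uq B b h := mk B b h (fK B b μ)

/-- The generator `E_i`. -/
def E (i : b.support) : Uq B b h := mk B b h (fE B b i)

/-- The generator `F_i`. -/
def F (i : b.support) : Uq B b h := mk B b h (fF B b i)

variable {B b h}

lemma mk_rel {x y : FreeUq B b} (hxy : Rel B b h x y) : mk B b h x = mk B b h y :=
  RingQuot.mkAlgHom_rel ℂ hxy

lemma K_zero : K B b h 0 = 1 := by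
  simpa using! mk_rel (Rel.K_zero (B := B) (b := b) (h := h))

lemma K_mul (l m : weightLattice B b) : K B b h l * K B b h m = K B b h (l + m) := by
  simpa using! mk_rel (Rel.K_mul (h := h) l m)

lemma K_neg_mul (l : weightLattice B b) : K B b h (-l) * K B b h l = 1 := by
  rw [K_mul, neg_add_cancel, K_zero]

lemma K_comm (l m : weightLattice B b) : K B b h l * K B b h m = K B b h m * K B b h l := by
  rw [K_mul, K_mul, add_comm]

lemma K_E (l : weightLattice B b) (j : b.support) :
    K B b h l * E B b h j * K B b h (-l) = qForm B h l (P.root j) • E B b h j := by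
  simpa using! mk_rel (Rel.K_E (h := h) l j)

lemma K_F (l : weightLattice B b) (j : b.support) :
    K B b h l * F B b h j * K B b h (-l) = (qForm B h l (P.root j))⁻¹ • F B b h j := by
  simpa using! mk_rel (Rel.K_F (h := h) l j)

lemma K_mul_E (l : weightLattice B b) (j : b.support) :
    K B b h l * E B b h j = qForm B h l (P.root j) • (E B b h j * K B b h l) := by
  rw [← smul_mul_assoc, ← K_E, mul_assoc _ _ (K B b h l), K_neg_mul, mul_one]

lemma K_mul_F (l : weightLattice B b) (j : b.support) :
    K B b h l * F B b h j = (qForm B h l (P.root j))⁻¹ • (F B b h j * K B b h l) := by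
  rw [← smul_mul_assoc, ← K_F, mul_assoc _ _ (K B b h l), K_neg_mul, mul_one]

lemma E_F_self (i : b.support) :
    E B b h i * F B b h i - F B b h i * E B b h i =
      (qRoot B b h i - (qRoot B b h i)⁻¹)⁻¹ •
          (K B b h (simpleRoot B b i) - K B b h (-simpleRoot B b i)) := by
  simpa using! mk_rel (Rel.E_F_self (B := B) (h := h) i)

lemma E_F_ne {i j : b.support} (hij : i ≠ j) :
    E B b h i * F B b h j - F B b h j * E B b h i = 0 := by
  simpa using! mk_rel (Rel.E_F_ne (B := B) (h := h) i j hij)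

lemma serre_E {i j : b.support} (hij : i ≠ j) :
    qSerre (qRoot B b h i) (serreExp b i j) (E B b h i) (E B b h j) = 0 := by
  simpa [map_qSerre] using! mk_rel (Rel.serre_E (B := B) (h := h) i j hij)

lemma serre_F {i j : b.support} (hij : i ≠ j) :
    qSerre (qRoot B b h i) (serreExp b i j) (F B b h i) (F B b h j) = 0 := by
  simpa [map_qSerre] using! mk_rel (Rel.serre_F (B := B) (h := h) i j hij)

end Uq

end Algebra

/-! ### The comultiplication -/

section Comul

variable {ι M N : Type*} [AddCommGroup M] [Module ℂ M] [AddCommGroup N] [Module ℂ N]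
  {P : RootPairing ι ℂ M N} [P.IsCrystallographic]
  (B : P.RootPositiveForm ℝ) (b : P.Base) (h : ℝˣ)

lemma qForm_neg_left (l m : M) : qForm B h (-l) m = (qForm B h l m)⁻¹ := by
  simp [qForm, Complex.exp_neg]

lemma qForm_ne_zero (l m : M) : qForm B h l m ≠ 0 := Complex.exp_ne_zero _

lemma qForm_symm (l m : M) : qForm B h l m = qForm B h m l := by
  have := B.symm.eq l m
  simp only [RingHom.id_apply] at this
  simp [qForm, this]

lemma qRoot_ne_zero (i : b.support) : qRoot B b h i ≠ 0 := Complex.exp_ne_zero _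

lemma qForm_self (i : b.support) : qForm B h (P.root i) (P.root i) = qRoot B b h i ^ 2 := by
  rw [qForm, qRoot, ← Complex.exp_nat_mul]
  congr 1
  push_cast
  ring

lemma qInt_qRoot_ne_zero (i : b.support) (m : ℕ) : qInt (qRoot B b h i) (m + 1) ≠ 0 := by
  obtain ⟨s, hs, hs'⟩ := B.exists_pos_eq i
  have hq : qRoot B b h i = ((Real.exp (h * (s / 2)) : ℝ) : ℂ) := by
    rw [qRoot, ← hs', Complex.ofReal_exp]
    simp
  have key : ∀ k : ℕ, k ≠ 0 → qRoot B b h i ^ k - (qRoot B b h i)⁻¹ ^ k ≠ 0 := by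
    intro k hk he
    rw [hq, ← Complex.ofReal_inv, ← Complex.ofReal_pow, ← Complex.ofReal_pow, ← Complex.ofReal_sub,
      Complex.ofReal_eq_zero, ← Real.exp_neg, ← Real.exp_nat_mul, ← Real.exp_nat_mul,
      sub_eq_zero, Real.exp_eq_exp] at he
    have hh : (h : ℝ) ≠ 0 := h.ne_zero
    have hk' : (k : ℝ) ≠ 0 := Nat.cast_ne_zero.mpr hk
    have : (k : ℝ) * (h * s) = 0 := by linarith
    simp [hk', hs.ne'] at this
  exact div_ne_zero (key _ (Nat.succ_ne_zero m)) (by simpa using key 1 one_ne_zero)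

lemma exists_serreExp [Finite ι] {i j : b.support} (hij : i ≠ j) :
    ∃ m, serreExp b i j = m + 1 ∧
      qForm B h (P.root i) (P.root j) = (qRoot B b h i)⁻¹ ^ m := by
  have hle : b.cartanMatrix j i ≤ 0 := b.cartanMatrix_le_zero_of_ne j i hij.symm
  obtain ⟨m, hm⟩ := Int.exists_eq_neg_ofNat hle
  refine ⟨m, by rw [serreExp, hm]; omega, ?_⟩
  have h1 := B.two_mul_apply_root_root j i
  have h3 : ((b.cartanMatrix j i : ℤ) : ℂ) = P.pairing j i := P.algebraMap_pairingIn ℤ j i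
  rw [hm] at h3
  push_cast at h3
  rw [qForm_symm, qForm, qRoot, ← Complex.exp_neg, ← Complex.exp_nat_mul]
  congr 1
  rw [← h3] at h1
  linear_combination ((h : ℝ) : ℂ) / 2 * h1

/-- The values of the comultiplication on the generators:
`K_μ ↦ K_μ ⊗ K_μ`, `E_i ↦ E_i ⊗ K_i + 1 ⊗ E_i`, `F_i ↦ F_i ⊗ 1 + K_i⁻¹ ⊗ F_i`. -/
def comulGen : Gen B b → Uq B b h ⊗[ℂ] Uq B b h
  | .K μ => Uq.K B b h μ ⊗ₜ Uq.K B b h μ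
  | .E i => Uq.E B b h i ⊗ₜ Uq.K B b h (simpleRoot B b i) + 1 ⊗ₜ Uq.E B b h i
  | .F i => Uq.F B b h i ⊗ₜ 1 + Uq.K B b h (-simpleRoot B b i) ⊗ₜ Uq.F B b h i

lemma comul_E_F (i j : b.support) :
    comulGen B b h (.E i) * comulGen B b h (.F j) - comulGen B b h (.F j) * comulGen B b h (.E i) =
      (Uq.E B b h i * Uq.F B b h j - Uq.F B b h j * Uq.E B b h i) ⊗ₜ
          Uq.K B b h (simpleRoot B b i) +
        Uq.K B b h (-simpleRoot B b j) ⊗ₜ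
          (Uq.E B b h i * Uq.F B b h j - Uq.F B b h j * Uq.E B b h i) := by
  have e1 : Uq.K B b h (simpleRoot B b i) * Uq.F B b h j =
      (qForm B h (P.root i) (P.root j))⁻¹ • (Uq.F B b h j * Uq.K B b h (simpleRoot B b i)) :=
    Uq.K_mul_F _ _
  have e2 : Uq.K B b h (-simpleRoot B b j) * Uq.E B b h i =
      (qForm B h (P.root i) (P.root j))⁻¹ • (Uq.E B b h i * Uq.K B b h (-simpleRoot B b j)) := by
    rw [Uq.K_mul_E, qForm_symm B h (P.root i), ← qForm_neg_left]
    rfl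
  simp only [comulGen, mul_add, add_mul, Algebra.TensorProduct.tmul_mul_tmul, mul_one, one_mul,
    e1, e2, TensorProduct.smul_tmul', TensorProduct.tmul_smul, TensorProduct.sub_tmul,
    TensorProduct.tmul_sub]
  abel

lemma comul_serre_E [Finite ι] {i j : b.support} (hij : i ≠ j) :
    qSerre (qRoot B b h i) (serreExp b i j) (comulGen B b h (.E i)) (comulGen B b h (.E j)) = 0 := by
  obtain ⟨m, hm, hf⟩ := exists_serreExp B b h hij
  have hs := Uq.serre_E (B := B) (h := h) hij
  rw [hm] at hs ⊢
  have h0 := qRoot_ne_zero B b h i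
  refine qSerre_coproduct h0 (qInt_qRoot_ne_zero B b h i) ?_ ?_ ?_ ?_ ?_
  · have e : Uq.K B b h (simpleRoot B b i) * Uq.E B b h i =
      qForm B h (P.root i) (P.root i) • (Uq.E B b h i * Uq.K B b h (simpleRoot B b i)) :=
      Uq.K_mul_E _ _
    simp [e, qForm_self]
  · have e : Uq.K B b h (simpleRoot B b i) * Uq.E B b h j =
      qForm B h (P.root i) (P.root j) • (Uq.E B b h j * Uq.K B b h (simpleRoot B b i)) :=
      Uq.K_mul_E _ _
    simp [e, hf]
  · have e : Uq.K B b h (simpleRoot B b j) * Uq.E B b h i =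
      qForm B h (P.root j) (P.root i) • (Uq.E B b h i * Uq.K B b h (simpleRoot B b j)) :=
      Uq.K_mul_E _ _
    rw [qForm_symm, hf] at e
    rw [Algebra.TensorProduct.tmul_mul_tmul, Algebra.TensorProduct.tmul_mul_tmul, e,
      TensorProduct.tmul_smul, smul_smul, ← mul_pow, mul_inv_cancel₀ h0, one_pow, one_smul,
      one_mul, mul_one]
  · rw [qSerre_tmul_left _ _ _ _ _ _ (Uq.K_comm _ _), hs, TensorProduct.zero_tmul]
  · rw [qSerre_tmul_right _ _ _ _ _ _ rfl, hs, TensorProduct.tmul_zero]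

lemma comul_serre_F [Finite ι] {i j : b.support} (hij : i ≠ j) :
    qSerre (qRoot B b h i) (serreExp b i j) (comulGen B b h (.F i)) (comulGen B b h (.F j)) = 0 := by
  obtain ⟨m, hm, hf⟩ := exists_serreExp B b h hij
  have hs := Uq.serre_F (B := B) (h := h) hij
  rw [hm] at hs ⊢
  have h0 := qRoot_ne_zero B b h i
  have key : ∀ k l : b.support, Uq.K B b h (-simpleRoot B b k) * Uq.F B b h l =
      qForm B h (P.root k) (P.root l) • (Uq.F B b h l * Uq.K B b h (-simpleRoot B b k)) := by
    intro k l
    have e : qForm B h ((-simpleRoot B b k : weightLattice B b) : M) (P.root l) =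
        (qForm B h (P.root k) (P.root l))⁻¹ := qForm_neg_left B h _ _
    rw [Uq.K_mul_F, e, inv_inv]
  rw [comulGen, comulGen, add_comm (_ ⊗ₜ _), add_comm (Uq.F B b h j ⊗ₜ _)]
  refine qSerre_coproduct h0 (qInt_qRoot_ne_zero B b h i) ?_ ?_ ?_ ?_ ?_
  · simp [key, qForm_self, TensorProduct.smul_tmul']
  · simp [key, hf, TensorProduct.smul_tmul']
  · have e := key j i
    rw [qForm_symm, hf] at e
    rw [Algebra.TensorProduct.tmul_mul_tmul, Algebra.TensorProduct.tmul_mul_tmul, e,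
      ← TensorProduct.smul_tmul', smul_smul, ← mul_pow, mul_inv_cancel₀ h0, one_pow, one_smul,
      one_mul, mul_one]
  · rw [qSerre_tmul_right _ _ _ _ _ _ (Uq.K_comm _ _), hs, TensorProduct.tmul_zero]
  · rw [qSerre_tmul_left _ _ _ _ _ _ rfl, hs, TensorProduct.zero_tmul]

lemma comulGen_rel [Finite ι] ⦃x y : FreeUq B b⦄ (hxy : Rel B b h x y) :
    FreeAlgebra.lift ℂ (comulGen B b h) x = FreeAlgebra.lift ℂ (comulGen B b h) y := by
  have hKneg : ∀ l : weightLattice B b, Uq.K B b h l * Uq.K B b h (-l) = 1 := fun l => by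
    rw [Uq.K_comm, Uq.K_neg_mul]
  have hKK : ∀ l m : weightLattice B b,
      Uq.K B b h l * Uq.K B b h m * Uq.K B b h (-l) = Uq.K B b h m := fun l m => by
    rw [Uq.K_comm l m, mul_assoc, hKneg, mul_one]
  induction hxy with
  | K_zero => simp [fK, comulGen, Uq.K_zero, Algebra.TensorProduct.one_def]
  | K_mul l m => simp [fK, comulGen, Uq.K_mul]
  | K_E l j =>
    simp only [fK, fE, map_mul, map_smul, FreeAlgebra.lift_ι_apply, comulGen, mul_add, add_mul,
      Algebra.TensorProduct.tmul_mul_tmul, Uq.K_E, hKK, mul_one, hKneg, smul_add,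
      TensorProduct.smul_tmul', TensorProduct.tmul_smul]
  | K_F l j =>
    simp only [fK, fF, map_mul, map_smul, FreeAlgebra.lift_ι_apply, comulGen, mul_add, add_mul,
      Algebra.TensorProduct.tmul_mul_tmul, Uq.K_F, hKK, mul_one, hKneg, smul_add,
      TensorProduct.smul_tmul', TensorProduct.tmul_smul]
  | E_F_self i =>
    simp only [fK, fE, fF, map_mul, map_smul, map_sub, FreeAlgebra.lift_ι_apply, comul_E_F,
      Uq.E_F_self]
    simp only [comulGen, ← TensorProduct.smul_tmul', TensorProduct.tmul_smul,
      TensorProduct.sub_tmul, TensorProduct.tmul_sub, smul_sub]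
    abel
  | E_F_ne i j hij =>
    simp only [fE, fF, map_mul, map_sub, map_zero, FreeAlgebra.lift_ι_apply, comul_E_F,
      Uq.E_F_ne hij, TensorProduct.zero_tmul, TensorProduct.tmul_zero, add_zero]
  | serre_E i j hij =>
    simp only [map_qSerre, fE, FreeAlgebra.lift_ι_apply, map_zero, comul_serre_E B b h hij]
  | serre_F i j hij =>
    simp only [map_qSerre, fF, FreeAlgebra.lift_ι_apply, map_zero, comul_serre_F B b h hij]

/-- The comultiplication of `U_q(𝔤)`. -/
def Uq.comul [Finite ι] : Uq B b h →ₐ[ℂ] Uq B b h ⊗[ℂ] Uq B b h :=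
  RingQuot.liftAlgHom ℂ ⟨FreeAlgebra.lift ℂ (comulGen B b h), comulGen_rel B b h⟩

end Comul

/-! ### Weights, category `𝒪`, Verma modules, simple modules, tensor products -/

section Weights

variable {ι M N : Type*} [AddCommGroup M] [Module ℂ M] [AddCommGroup N] [Module ℂ N]
  {P : RootPairing ι ℂ M N} [P.IsCrystallographic]
  (B : P.RootPositiveForm ℝ) (b : P.Base) (h : ℝˣ)

/-- The subgroup `i ℏ⁻¹ Q^∨` of the space of weights, where `ℏ = h / 2π` and `Q^∨` is the lattice
spanned by the simple coroots. -/
def periodLattice : AddSubgroup M :=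
  AddSubgroup.closure (Set.range fun j : b.support =>
    (Complex.I * (((h : ℝ) : ℂ) / (2 * Real.pi))⁻¹) • simpleCoroot B b j)

/-- The parameter space of weights `𝔥_q^* = 𝔥^* / i ℏ⁻¹ Q^∨`. -/
abbrev QWeight : Type _ := M ⧸ periodLattice B b h

lemma qForm_periodLattice {l : M} (hl : l ∈ periodLattice B b h) {m : M}
    (hm : m ∈ weightLattice B b) : qForm B h l m = 1 := by
  induction hl using AddSubgroup.closure_induction with
  | mem x hx =>
    obtain ⟨j, rfl⟩ := hx
    obtain ⟨n, hn⟩ := hm j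
    have hh : ((h : ℝ) : ℂ) ≠ 0 := Complex.ofReal_ne_zero.mpr h.ne_zero
    have hpi : (Real.pi : ℂ) ≠ 0 := Complex.ofReal_ne_zero.mpr Real.pi_ne_zero
    rw [qForm_symm, qForm, map_smul, hn, Complex.exp_eq_one_iff]
    refine ⟨n, ?_⟩
    simp only [smul_eq_mul]
    field_simp
  | zero => simp [qForm]
  | add x y _ _ hx hy =>
    have : qForm B h (x + y) m = qForm B h x m * qForm B h y m := by
      simp [qForm, mul_add, Complex.exp_add]
    rw [this, hx, hy, one_mul]
  | neg x _ hx => rw [qForm_neg_left, hx, inv_one]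

/-- The number `q ^ (λ, μ)` for `λ ∈ 𝔥_q^*` and `μ` in the weight lattice. -/
def QWeight.eval (l : QWeight B b h) (m : weightLattice B b) : ℂ :=
  Quotient.liftOn' l (fun x => qForm B h x m) fun x y hxy => by
    have h1 := qForm_periodLattice B b h (QuotientAddGroup.leftRel_apply.mp hxy) m.2
    have h2 : qForm B h (-x + y) m = (qForm B h x m)⁻¹ * qForm B h y m := by
      simp [qForm, mul_add, Complex.exp_add, Complex.exp_neg]
    rw [h2] at h1
    exact (inv_mul_eq_one₀ (qForm_ne_zero B h x m)).mp h1

/-- The weight space of weight `l` in a `U_q(𝔤)`-module. -/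
def weightSpace (V : Type*) [AddCommGroup V] [Module ℂ V] [Module (Uq B b h) V]
    [IsScalarTower ℂ (Uq B b h) V] (l : QWeight B b h) : Submodule ℂ V where
  carrier := {v | ∀ m : weightLattice B b, Uq.K B b h m • v = l.eval B b h m • v}
  zero_mem' := fun m => by simp
  add_mem' := fun hx hy m => by rw [smul_add, smul_add, hx m, hy m]
  smul_mem' := fun c x hx m => by
    rw [← algebraMap_smul (Uq B b h) c x, ← mul_smul, ← Algebra.commutes, mul_smul, hx m,
      algebraMap_smul, algebraMap_smul, smul_comm]

/-- The subalgebra `U_q(𝔫_+)` generated by the `E_i`. -/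
def Uq.nPlus : Subalgebra ℂ (Uq B b h) := Algebra.adjoin ℂ (Set.range (Uq.E B b h))

/-- The subspace `U_q(𝔫_+) · v`. -/
def nPlusOrbit {V : Type*} [AddCommGroup V] [Module ℂ V] [Module (Uq B b h) V]
    [IsScalarTower ℂ (Uq B b h) V] (v : V) : Submodule ℂ V :=
  (Subalgebra.toSubmodule (Uq.nPlus B b h)).map
    ((LinearMap.toSpanSingleton (Uq B b h) V v).restrictScalars ℂ)

open Classical in
/-- Membership of a `U_q(𝔤)`-module in the BGG category `𝒪`. -/
structure InCategoryO (V : Type*) [AddCommGroup V] [Module ℂ V] [Module (Uq B b h) V]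
    [IsScalarTower ℂ (Uq B b h) V] : Prop where
  finite : Module.Finite (Uq B b h) V
  isInternal_weightSpace : DirectSum.IsInternal fun l : QWeight B b h => weightSpace B b h V l
  finiteDimensional_nPlusOrbit : ∀ v : V, FiniteDimensional ℂ (nPlusOrbit B b h v)

/-- The left ideal of `U_q(𝔤)` generated by all `E_i` and all `K_μ - q ^ (λ, μ)`. -/
def vermaIdeal (l : QWeight B b h) : Submodule (Uq B b h) (Uq B b h) :=
  Submodule.span (Uq B b h)
    (Set.range (Uq.E B b h) ∪
      Set.range fun m : weightLattice B b =>
        Uq.K B b h m - algebraMap ℂ (Uq B b h) (l.eval B b h m))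

/-- The Verma module `M(λ)`. The induced module `U_q(𝔤) ⊗_{U_q(𝔟_+)} ℂ_λ` is the quotient of
`U_q(𝔤)` by the left ideal generated by the kernel of the character `χ_λ` of `U_q(𝔟_+)`, and this
kernel is generated by the elements `E_i` and `K_μ - χ_λ(K_μ)`. -/
abbrev Verma (l : QWeight B b h) : Type _ := Uq B b h ⧸ vermaIdeal B b h l

/-- The highest weight vector `v_λ` of `M(λ)`. -/
def Verma.hwVector (l : QWeight B b h) : Verma B b h l :=
  Submodule.Quotient.mk 1

/-- The submodule `I(λ)` of `M(λ)`: the sum of all submodules not containing `v_λ`. -/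
def Verma.maxSubmodule (l : QWeight B b h) : Submodule (Uq B b h) (Verma B b h l) :=
  sSup {W | Verma.hwVector B b h l ∉ W}

/-- The simple highest weight module `V(λ) = M(λ) / I(λ)`. -/
abbrev SimpleHW (l : QWeight B b h) : Type _ := Verma B b h l ⧸ Verma.maxSubmodule B b h l

end Weights

section Tensor

variable {ι M N : Type*} [Finite ι] [AddCommGroup M] [Module ℂ M] [AddCommGroup N] [Module ℂ N]
  {P : RootPairing ι ℂ M N} [P.IsCrystallographic]
  (B : P.RootPositiveForm ℝ) (b : P.Base) (h : ℝˣ)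

/-- The tensor product over `ℂ` of two `U_q(𝔤)`-modules; it is a type synonym, so that it carries
only the `U_q(𝔤)`-action that comes from the comultiplication. -/
@[nolint unusedArguments]
def UqTensor (V W : Type*)
    [AddCommGroup V] [Module ℂ V] [Module (Uq B b h) V] [IsScalarTower ℂ (Uq B b h) V]
    [AddCommGroup W] [Module ℂ W] [Module (Uq B b h) W] [IsScalarTower ℂ (Uq B b h) W] : Type _ :=
  V ⊗[ℂ] W

variable (V W : Type*)
    [AddCommGroup V] [Module ℂ V] [Module (Uq B b h) V] [IsScalarTower ℂ (Uq B b h) V]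
    [AddCommGroup W] [Module ℂ W] [Module (Uq B b h) W] [IsScalarTower ℂ (Uq B b h) W]

instance : AddCommGroup (UqTensor B b h V W) := inferInstanceAs (AddCommGroup (V ⊗[ℂ] W))

instance : Module ℂ (UqTensor B b h V W) := inferInstanceAs (Module ℂ (V ⊗[ℂ] W))

/-- The action of `U_q(𝔤)` on `V ⊗ W`: the element `x` acts by `∑ x₍₁₎ ⊗ x₍₂₎`, where
`∑ x₍₁₎ ⊗ x₍₂₎` is the comultiplication of `x`. -/
def UqTensor.action : Uq B b h →ₐ[ℂ] Module.End ℂ (V ⊗[ℂ] W) :=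
  ((Module.endTensorEndAlgHom (R := ℂ) (S := ℂ) (A := ℂ) (M := V) (N := W)).comp
    (Algebra.TensorProduct.map (Algebra.lsmul ℂ ℂ V) (Algebra.lsmul ℂ ℂ W))).comp
      (Uq.comul B b h)

instance : Module (Uq B b h) (UqTensor B b h V W) :=
  Module.compHom (V ⊗[ℂ] W) (UqTensor.action B b h V W).toRingHom

lemma UqTensor.smul_def (x : Uq B b h) (t : V ⊗[ℂ] W) :
    (HSMul.hSMul x (show UqTensor B b h V W from t) : UqTensor B b h V W) =
      UqTensor.action B b h V W x t := rfl

instance : IsScalarTower ℂ (Uq B b h) (UqTensor B b h V W) where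
  smul_assoc c x t :=
    LinearMap.congr_fun (map_smul (UqTensor.action B b h V W) c x) t

end Tensor

end QuantumCatO

end

/-! Isomorphism. Write V for V(μ) and v_λ for the highest weight vector of M(λ). Each tensor product
behaves like a module induced from U_q(b_+): linear maps out of it correspond to suitable linear
maps out of v_λ ⊗ V or V ⊗ v_λ (`exists_lift_verma_tensor`, `exists_lift_tensor_verma`), and these
subspaces generate (`span_hwVector_tmul`, `span_tmul_hwVector`). The K_m act on both in the same
way, but E_i sends v_λ ⊗ v to v_λ ⊗ E_i v and v ⊗ v_λ to q^(λ,α_i) E_i v ⊗ v_λ. An automorphism D of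
V that commutes with all K_m and satisfies D E_i = q^(λ,α_i) E_i D absorbs the discrepancy
(`nonempty_tensor_verma_equiv`). On V(μ) such a D is induced by the automorphism E_i ↦ c_i E_i, F_i
↦ c_i⁻¹ F_i of U_q(g) with c_i = q^(λ,α_i) (`SimpleHW.exists_twist`).

Failure to lie in O. A module in O is generated by a finite-dimensional subspace G stable under all
K_m and E_i, so G already spans it under the F_i alone; hence any linear quotient killing all F_i W
is an image of G and is finite-dimensional (`InCategoryO.finiteDimensional_of_coinvariants`). On the
other hand v ⊗ y v_λ ↦ S⁻¹(y) v, for y a polynomial in the F_i, kills every F_i(V ⊗ M(λ)) and maps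
onto V. So V ⊗ M(λ) in O would force V to be finite-dimensional, and the isomorphism carries this
over to M(λ) ⊗ V.

The last map is well defined only if y can be recovered from y v_λ. This is the technical part: the
algebra `NMinus` presented by the F_i and their Serre relations is made into a highest weight
module, which yields a map M(λ) → `NMinus` compatible with the F_i (`NMinus.exists_verma_map`). The
operators E_i are built from their commutators with the F_j, encoded as homomorphisms into dual
numbers; that these respect the Serre relations is a first-order computation with iterated
q-commutators. -/

noncomputable section

namespace QuantumCatO

/-! ### Quantum Serre expressions under rescaling, reversal and twisting -/

section Serre

variable {A : Type*} [Ring A] [Algebra ℂ A]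

lemma qSerre_smul_smul (q : ℂ) (n : ℕ) (c d : ℂ) (x y : A) :
    qSerre q n (c • x) (d • y) = (c ^ n * d) • qSerre q n x y := by
  simp only [qSerre, Finset.smul_sum]
  refine Finset.sum_congr rfl fun k hk => ?_
  have hk : k ≤ n := by simpa [Nat.lt_succ_iff] using hk
  simp only [smul_pow, smul_mul_assoc, mul_smul_comm, smul_smul]
  congr 1
  rw [← Nat.sub_add_cancel hk, pow_add, Nat.add_sub_cancel]
  ring

lemma qBinom_symm (q : ℂ) {n k : ℕ} (hk : k ≤ n) : qBinom q n (n - k) = qBinom q n k := by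
  rw [qBinom, qBinom, if_pos hk, if_pos (Nat.sub_le n k), Nat.sub_sub_self hk, mul_comm]

open MulOpposite in
-- Reversing products exchanges the exponents k and n - k. The q-binomial is symmetric under this
-- and the sign changes by (-1)^n, so Serre relations survive in the opposite algebra.
lemma qSerre_op (q : ℂ) (n : ℕ) (x y : A) :
    qSerre q n (op x) (op y) = (-1 : ℂ) ^ n • op (qSerre q n x y) := by
  rw [qSerre, ← Finset.sum_range_reflect, qSerre, Finset.op_sum, Finset.smul_sum]
  refine Finset.sum_congr rfl fun k hk => ?_
  have hk : k ≤ n := by simpa [Nat.lt_succ_iff] using hk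
  have e : n + 1 - 1 - k = n - k := by omega
  rw [e, qBinom_symm q hk, Nat.sub_sub_self hk, op_smul, smul_smul, op_mul, op_mul, op_pow, op_pow,
    ← mul_assoc ((-1 : ℂ) ^ n), ← mul_assoc (op x ^ k)]
  congr 2
  rw [← Nat.sub_add_cancel hk, pow_add, Nat.add_sub_cancel, mul_assoc, ← mul_pow]
  simp

lemma qIter_succ (c : ℕ → ℂ) (x y : A) (m : ℕ) :
    qIter c x y (m + 1) = x * qIter c x y m - c m • (qIter c x y m * x) := rfl

/-- All factors k and l can be pushed to the right at the cost of scalars. Because `hky` and `hlx`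
involve the same s, both terms of each q-commutator pick up the same factor s r^m. -/
lemma qIter_mul_right {x y k l : A} {r s : ℂ} (hkx : k * x = r • (x * k))
    (hky : k * y = s • (y * k)) (hlx : l * x = s • (x * l)) (hkl : k * l = l * k)
    (c : ℕ → ℂ) (m : ℕ) :
    ∃ d : ℂ, qIter c (x * k) (y * l) m = d • (qIter c x y m * (k ^ m * l)) := by
  induction m with
  | zero => exact ⟨1, by simp [qIter]⟩
  | succ m ih =>
    obtain ⟨d, hd⟩ := ih
    have hp : ∀ m : ℕ, k ^ m * x = r ^ m • (x * k ^ m) := fun m => by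
      induction m with
      | zero => simp
      | succ m ih =>
        rw [pow_succ', mul_assoc, ih, mul_smul_comm, ← mul_assoc, hkx, smul_mul_assoc, smul_smul,
          pow_succ r, mul_assoc]
    have hkz := qIter_comm hky hkx c m
    have hc : k ^ m * l * k = k ^ (m + 1) * l := by
      rw [mul_assoc, ← hkl, ← mul_assoc, pow_succ]
    refine ⟨d * (s * r ^ m), ?_⟩
    have e1 : x * k * (qIter c x y m * (k ^ m * l)) =
        (s * r ^ m) • (x * qIter c x y m * (k ^ (m + 1) * l)) := by
      rw [mul_assoc, ← mul_assoc k, hkz, smul_mul_assoc, mul_smul_comm, pow_succ']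
      simp only [mul_assoc]
    have e2 : qIter c x y m * (k ^ m * l) * (x * k) =
        (s * r ^ m) • (qIter c x y m * x * (k ^ (m + 1) * l)) := by
      have : (k ^ m * l) * x = (s * r ^ m) • (x * (k ^ m * l)) := by
        rw [mul_assoc, hlx, mul_smul_comm, ← mul_assoc, hp, smul_mul_assoc, smul_smul, mul_assoc]
      rw [mul_assoc, ← mul_assoc _ x, this, smul_mul_assoc, mul_smul_comm, mul_assoc x, hc,
        mul_assoc (qIter c x y m)]
    rw [qIter, hd, mul_smul_comm, smul_mul_assoc, e1, e2, qIter, sub_mul, smul_sub, smul_mul_assoc]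
    simp only [smul_smul]
    congr 2
    ring

/-- Needed for the antipode, whose values on E_i and F_i are, up to scalars, E_i K_i⁻¹ and F_i K_i.
-/
lemma qSerre_mul_right {q : ℂ} (h0 : q ≠ 0) (hq : ∀ m, qInt q (m + 1) ≠ 0) {x y k l : A}
    {r s : ℂ} {m : ℕ} (hkx : k * x = r • (x * k)) (hky : k * y = s • (y * k))
    (hlx : l * x = s • (x * l)) (hkl : k * l = l * k) (h : qSerre q (m + 1) x y = 0) :
    qSerre q (m + 1) (x * k) (y * l) = 0 := by
  rw [qSerre_eq_qIter h0 hq] at h ⊢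
  obtain ⟨d, hd⟩ := qIter_mul_right hkx hky hlx hkl (fun k => q⁻¹ ^ m * q ^ (2 * k)) (m + 1)
  rw [hd, h, zero_mul, smul_zero]

/-- The first q-commutator vanishes by hypothesis, and every later one is built from its
predecessor. -/
lemma qIter_eq_zero {c : ℕ → ℂ} {x y : A} (h : x * y = c 0 • (y * x)) (m : ℕ) :
    qIter c x y (m + 1) = 0 := by
  induction m with
  | zero => simp [qIter, h]
  | succ m ih => rw [qIter, ih]; simp

lemma qSerre_eq_zero_of_mul {q : ℂ} (h0 : q ≠ 0) (hq : ∀ m, qInt q (m + 1) ≠ 0) {x y : A} {m : ℕ}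
    (h : x * y = q⁻¹ ^ m • (y * x)) : qSerre q (m + 1) x y = 0 := by
  rw [qSerre_eq_qIter h0 hq]
  exact qIter_eq_zero (by simpa using h) m

lemma qSerre_smul_right (q : ℂ) (n : ℕ) (c : ℂ) (x y : A) :
    qSerre q n x (c • y) = c • qSerre q n x y := by
  simpa using qSerre_smul_smul q n 1 c x y

lemma qSerre_neg_right (q : ℂ) (n : ℕ) (x y : A) : qSerre q n x (-y) = - qSerre q n x y := by
  simpa using qSerre_smul_right q n (-1) x y

/-! ### First-order deformations of the Serre expression over dual numbers -/

open TrivSqZeroExt in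
/-- Deforming `f` to `f + ε s (k - k⁻¹)` over the dual numbers preserves the quantum Serre
expression. -/
lemma qSerre_dualNumber_left {q s : ℂ} (h0 : q ≠ 0) (hq : ∀ m, qInt q (m + 1) ≠ 0) {f y k k' : A}
    {m : ℕ} (hkf : k * f = q⁻¹ ^ 2 • (f * k)) (hkf' : k' * f = q ^ 2 • (f * k'))
    (hky : k * y = q ^ m • (y * k)) (hky' : k' * y = q⁻¹ ^ m • (y * k')) :
    qSerre q (m + 1) (inl f + inr (s • (k - k')) : DualNumber A) (inl y) =
      inl (qSerre q (m + 1) f y) := by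
  rw [qSerre_eq_qIter h0 hq, qSerre_eq_qIter h0 hq]
  set c : ℕ → ℂ := fun k => q⁻¹ ^ m * q ^ (2 * k) with hc
  have hX : q * q⁻¹ = 1 := mul_inv_cancel₀ h0
  have hXn : ∀ n : ℕ, q ^ n * q⁻¹ ^ n = 1 := fun n => by rw [← mul_pow, hX, one_pow]
  have hcs : ∀ n, c (n + 1) * q⁻¹ ^ 2 = c n := fun n => by
    simp only [hc]
    rw [mul_add, pow_add, mul_one]
    linear_combination (q⁻¹ ^ m * q ^ (2 * n)) * hXn 2
  set g : ℕ → ℂ := fun n => q ^ m * q⁻¹ ^ (2 * n) - q⁻¹ ^ m * q ^ (2 * n) with hg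
  have key : ∀ n, qIter c (inl f + inr (s • (k - k')) : DualNumber A) (inl y) (n + 1) =
      inl (qIter c f y (n + 1)) +
        inr ((s * ∑ j ∈ Finset.range (n + 1), g j) • (qIter c f y n * k)) := by
    -- The scalar c n is exactly the one with which k' passes the n-th iterate, so the k' terms
    -- cancel and only k survives, with coefficient g n.
    have hz : ∀ n, (s • (k - k')) * qIter c f y n - c n • (qIter c f y n * (s • (k - k'))) =
        (s * g n) • (qIter c f y n * k) := fun n => by
      rw [smul_mul_assoc, sub_mul, qIter_comm hky hkf, qIter_comm hky' hkf', mul_smul_comm, mul_sub]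
      simp only [hg, hc, ← pow_mul]
      module
    intro n
    induction n with
    | zero =>
      have := hz 0
      simp only [qIter] at this
      ext
      · simp [qIter]
      · simp [qIter, ← this]
    | succ n ih =>
      rw [qIter_succ, ih, qIter_succ c f y (n + 1), Finset.sum_range_succ _ (n + 1), mul_add s,
        add_smul, ← hz (n + 1)]
      -- Moving k past f costs q⁻², which turns c (n + 1) into c n; the ε-part accumulated so far
      -- thus becomes the next iterate times k, with unchanged coefficient.
      have e : (s * ∑ j ∈ Finset.range (n + 1), g j) • (qIter c f y (n + 1) * k) =
          f * ((s * ∑ j ∈ Finset.range (n + 1), g j) • (qIter c f y n * k)) -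
          c (n + 1) • (((s * ∑ j ∈ Finset.range (n + 1), g j) • (qIter c f y n * k)) * f) := by
        rw [mul_smul_comm, smul_mul_assoc, mul_assoc _ k f, hkf, mul_smul_comm,
          smul_comm (c (n + 1)),
          smul_smul (c (n + 1)), hcs, ← smul_sub, qIter_succ, sub_mul, smul_mul_assoc]
        simp only [mul_assoc]
      rw [e]
      ext
      · simp [qIter]
      · simp [smul_add]
        abel
  -- Here g j = q^(m-2j) - q^(2j-m) is odd under the reflection j ↦ m - j.
  have hsum : ∑ j ∈ Finset.range (m + 1), g j = 0 := by
    simp only [hg, Finset.sum_sub_distrib]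
    rw [sub_eq_zero, ← Finset.sum_range_reflect]
    refine Finset.sum_congr rfl fun j hj => ?_
    obtain ⟨p, rfl⟩ : ∃ p, m = j + p := ⟨m - j, by simp at hj; omega⟩
    have e : j + p + 1 - 1 - j = p := by omega
    rw [e]
    have h1 := hXn p
    have h2 := hXn j
    rw [pow_add, pow_add, two_mul, two_mul, pow_add, pow_add]
    linear_combination (q ^ j * q⁻¹ ^ p) * h1 - (q ^ j * q⁻¹ ^ p) * h2
  rw [key, hsum]
  simp

open TrivSqZeroExt in
/-- Deforming `y` to `y + ε s (k - k⁻¹)` over the dual numbers preserves the quantum Serre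
expression. -/
lemma qSerre_dualNumber_right {q s : ℂ} (h0 : q ≠ 0) (hq : ∀ m, qInt q (m + 1) ≠ 0) {f y k k' : A}
    {m : ℕ} (hkf : k * f = q ^ m • (f * k)) (hkf' : k' * f = q⁻¹ ^ m • (f * k')) :
    qSerre q (m + 1) (inl f : DualNumber A) (inl y + inr (s • (k - k'))) =
      inl (qSerre q (m + 1) f y) := by
  have hXn : q ^ m * q⁻¹ ^ m = 1 := by rw [← mul_pow, mul_inv_cancel₀ h0, one_pow]
  -- The expression is additive in its last argument, so it suffices that each ε-term contributes
  -- zero; for k already the first q-commutator with f vanishes.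
  have h1 : qSerre q (m + 1) (inl f : DualNumber A) (inr k) = 0 := by
    refine qSerre_eq_zero_of_mul h0 hq ?_
    ext
    · simp
    · simp [hkf, smul_smul, h0]
  have h2 : qSerre q (m + 1) (inl f : DualNumber A) (inr k') = 0 := by
    -- The element k' passes f with the inverse scalar, and the Serre expression is invariant under
    -- q ↦ q⁻¹.
    rw [← qSerre_inv]
    refine qSerre_eq_zero_of_mul (inv_ne_zero h0) (fun m => by rw [qInt_inv]; exact hq m) ?_
    ext
    · simp
    · simp [hkf', smul_smul, h0]
  have h3 : qSerre q (m + 1) (inl f : DualNumber A) (inl y) = inl (qSerre q (m + 1) f y) :=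
    (map_qSerre (inlAlgHom ℂ A A) q (m + 1) f y).symm
  rw [qSerre_add_right, h3, inr_smul, inr_sub, sub_eq_add_neg, qSerre_smul_right, qSerre_add_right,
    qSerre_neg_right, h1, h2]
  simp

open TrivSqZeroExt in
/-- The algebra homomorphism `x ↦ x + ε [e, x]` to the dual numbers. -/
def adDualNumber (e : A) : A →ₐ[ℂ] DualNumber A :=
  AlgHom.ofLinearMap
    ((inlAlgHom ℂ A A).toLinearMap +
      (inrHom A A).restrictScalars ℂ ∘ₗ (LinearMap.mulLeft ℂ e - LinearMap.mulRight ℂ e))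
    (by ext <;> simp)
    (fun x y => by
      ext
      · simp
      · simp
        noncomm_ring)

open TrivSqZeroExt in
lemma adDualNumber_apply (e x : A) : adDualNumber e x = inl x + inr (e * x - x * e) := rfl

-- Being a homomorphism, `adDualNumber e` sends the Serre expression S to S + ε[e, S]; the
-- hypothesis says that the ε-part is zero.
open TrivSqZeroExt in
lemma commute_qSerre_of_adDualNumber {q : ℂ} {n : ℕ} {e f y : A}
    (h : qSerre q n (adDualNumber e f) (adDualNumber e y) = inl (qSerre q n f y)) :
    e * qSerre q n f y = qSerre q n f y * e := by
  rw [← map_qSerre, adDualNumber_apply] at h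
  have := congrArg snd h
  simpa [sub_eq_zero] using this

end Serre

/-! ### Presentation of U_q(g) and its universal property -/

section Lift

variable {ι M N : Type*} [AddCommGroup M] [Module ℂ M] [AddCommGroup N] [Module ℂ N]
  {P : RootPairing ι ℂ M N} [P.IsCrystallographic]
  (B : P.RootPositiveForm ℝ) (b : P.Base) (h : ℝˣ)

/-- The assertion that the elements `k_μ`, `e_i`, `f_i` of an algebra satisfy the defining relations
of `U_q(𝔤)`. -/
structure SatisfiesRel {A : Type*} [Ring A] [Algebra ℂ A] (k : weightLattice B b → A)
    (e f : b.support → A) : Prop where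
  k_zero : k 0 = 1
  k_mul (l m : weightLattice B b) : k l * k m = k (l + m)
  k_e (l : weightLattice B b) (j : b.support) : k l * e j = qForm B h l (P.root j) • (e j * k l)
  k_f (l : weightLattice B b) (j : b.support) :
    k l * f j = (qForm B h l (P.root j))⁻¹ • (f j * k l)
  e_f_self (i : b.support) : e i * f i - f i * e i =
    (qRoot B b h i - (qRoot B b h i)⁻¹)⁻¹ • (k (simpleRoot B b i) - k (-simpleRoot B b i))
  e_f_ne (i j : b.support) (hij : i ≠ j) : e i * f j - f j * e i = 0
  serre_e (i j : b.support) (hij : i ≠ j) : qSerre (qRoot B b h i) (serreExp b i j) (e i) (e j) = 0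
  serre_f (i j : b.support) (hij : i ≠ j) : qSerre (qRoot B b h i) (serreExp b i j) (f i) (f j) = 0

variable {B b h}

/-- The values on the generators of a homomorphism from the free algebra. -/
def genVal {A : Type*} (k : weightLattice B b → A) (e f : b.support → A) : Gen B b → A
  | .K μ => k μ
  | .E i => e i
  | .F i => f i

lemma SatisfiesRel.lift_rel {A : Type*} [Ring A] [Algebra ℂ A] {k : weightLattice B b → A}
    {e f : b.support → A} (H : SatisfiesRel B b h k e f) ⦃x y : FreeUq B b⦄
    (hxy : Rel B b h x y) :
    FreeAlgebra.lift ℂ (genVal k e f) x = FreeAlgebra.lift ℂ (genVal k e f) y := by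
  have hk : ∀ l : weightLattice B b, k l * k (-l) = 1 := fun l => by
    rw [H.k_mul, add_neg_cancel, H.k_zero]
  induction hxy with
  | K_zero => simp [fK, genVal, H.k_zero]
  | K_mul l m => simp [fK, genVal, H.k_mul]
  | K_E l j =>
    simp only [fK, fE, genVal, map_mul, map_smul, FreeAlgebra.lift_ι_apply, H.k_e]
    rw [smul_mul_assoc, mul_assoc, hk, mul_one]
  | K_F l j =>
    simp only [fK, fF, genVal, map_mul, map_smul, FreeAlgebra.lift_ι_apply, H.k_f]
    rw [smul_mul_assoc, mul_assoc, hk, mul_one]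
  | E_F_self i => simp [fK, fE, fF, genVal, H.e_f_self]
  | E_F_ne i j hij => simp [fE, fF, genVal, H.e_f_ne i j hij]
  | serre_E i j hij => simp [map_qSerre, fE, genVal, H.serre_e i j hij]
  | serre_F i j hij => simp [map_qSerre, fF, genVal, H.serre_f i j hij]

/-- The universal property of `U_q(𝔤)`. -/
def SatisfiesRel.lift {A : Type*} [Ring A] [Algebra ℂ A] {k : weightLattice B b → A}
    {e f : b.support → A} (H : SatisfiesRel B b h k e f) : Uq B b h →ₐ[ℂ] A :=
  RingQuot.liftAlgHom ℂ ⟨FreeAlgebra.lift ℂ (genVal k e f), H.lift_rel⟩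

section

variable {A : Type*} [Ring A] [Algebra ℂ A] {k : weightLattice B b → A}
    {e f : b.support → A} (H : SatisfiesRel B b h k e f)

lemma SatisfiesRel.lift_mk (x : FreeUq B b) :
    H.lift (Uq.mk B b h x) = FreeAlgebra.lift ℂ (genVal k e f) x :=
  RingQuot.liftAlgHom_mkAlgHom_apply ..

@[simp] lemma SatisfiesRel.lift_K (m : weightLattice B b) : H.lift (Uq.K B b h m) = k m := by
  simp [Uq.K, lift_mk, fK, genVal]

@[simp] lemma SatisfiesRel.lift_E (i : b.support) : H.lift (Uq.E B b h i) = e i := by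
  simp [Uq.E, lift_mk, fE, genVal]

@[simp] lemma SatisfiesRel.lift_F (i : b.support) : H.lift (Uq.F B b h i) = f i := by
  simp [Uq.F, lift_mk, fF, genVal]

end

lemma Uq.comul_mk [Finite ι] (x : FreeUq B b) :
    Uq.comul B b h (Uq.mk B b h x) = FreeAlgebra.lift ℂ (comulGen B b h) x :=
  RingQuot.liftAlgHom_mkAlgHom_apply ..

@[simp] lemma Uq.comul_K [Finite ι] (m : weightLattice B b) :
    Uq.comul B b h (Uq.K B b h m) = Uq.K B b h m ⊗ₜ Uq.K B b h m := by
  simp [Uq.K, comul_mk, fK, comulGen]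

@[simp] lemma Uq.comul_E [Finite ι] (i : b.support) :
    Uq.comul B b h (Uq.E B b h i) =
      Uq.E B b h i ⊗ₜ Uq.K B b h (simpleRoot B b i) + 1 ⊗ₜ Uq.E B b h i := by
  simp [Uq.E, comul_mk, fE, comulGen]

@[simp] lemma Uq.comul_F [Finite ι] (i : b.support) :
    Uq.comul B b h (Uq.F B b h i) =
      Uq.F B b h i ⊗ₜ 1 + Uq.K B b h (-simpleRoot B b i) ⊗ₜ Uq.F B b h i := by
  simp [Uq.F, comul_mk, fF, comulGen]

lemma Uq.K_mul_neg (l : weightLattice B b) : Uq.K B b h l * Uq.K B b h (-l) = 1 := by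
  rw [Uq.K_comm, Uq.K_neg_mul]

lemma Uq.adjoin_eq_top : Algebra.adjoin ℂ
    (Set.range (Uq.K B b h) ∪ Set.range (Uq.E B b h) ∪ Set.range (Uq.F B b h)) = ⊤ := by
  have hs : Function.Surjective (Uq.mk B b h) := RingQuot.mkAlgHom_surjective ℂ _
  rw [eq_top_iff, ← (AlgHom.range_eq_top _).mpr hs, ← Algebra.map_top, ← FreeAlgebra.adjoin_range_ι,
    AlgHom.map_adjoin, ← Set.range_comp]
  refine Algebra.adjoin_mono ?_
  rintro _ ⟨g, rfl⟩
  cases g with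
  | K m => exact Or.inl (Or.inl ⟨m, rfl⟩)
  | E i => exact Or.inl (Or.inr ⟨i, rfl⟩)
  | F i => exact Or.inr ⟨i, rfl⟩

/-- A property of elements of `U_q(𝔤)` holds everywhere if it holds for the generators and is
preserved by the algebra operations. -/
lemma Uq.induction {p : Uq B b h → Prop} (hK : ∀ m, p (Uq.K B b h m)) (hE : ∀ i, p (Uq.E B b h i))
    (hF : ∀ i, p (Uq.F B b h i)) (hC : ∀ c, p (algebraMap ℂ (Uq B b h) c))
    (hadd : ∀ x y, p x → p y → p (x + y)) (hmul : ∀ x y, p x → p y → p (x * y)) (x : Uq B b h) :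
    p x := by
  have hx : x ∈ Algebra.adjoin ℂ
      (Set.range (Uq.K B b h) ∪ Set.range (Uq.E B b h) ∪ Set.range (Uq.F B b h)) := by
    rw [Uq.adjoin_eq_top]; trivial
  induction hx using Algebra.adjoin_induction with
  | mem x hx =>
    rcases hx with (⟨m, rfl⟩ | ⟨i, rfl⟩) | ⟨i, rfl⟩
    exacts [hK m, hE i, hF i]
  | algebraMap c => exact hC c
  | add x y _ _ hx hy => exact hadd x y hx hy
  | mul x y _ _ hx hy => exact hmul x y hx hy

lemma Uq.algHom_ext {A : Type*} [Ring A] [Algebra ℂ A] {φ ψ : Uq B b h →ₐ[ℂ] A}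
    (hK : ∀ m, φ (Uq.K B b h m) = ψ (Uq.K B b h m)) (hE : ∀ i, φ (Uq.E B b h i) = ψ (Uq.E B b h i))
    (hF : ∀ i, φ (Uq.F B b h i) = ψ (Uq.F B b h i)) : φ = ψ := by
  ext x
  induction x using Uq.induction with
  | hK m => exact hK m
  | hE i => exact hE i
  | hF i => exact hF i
  | hC c => simp
  | hadd x y hx hy => rw [map_add, map_add, hx, hy]
  | hmul x y hx hy => rw [map_mul, map_mul, hx, hy]

/-- A linear map between `U_q(𝔤)`-modules that commutes with the generators is `U_q(𝔤)`-linear. -/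
lemma Uq.map_smul_of_generators {V W : Type*} [AddCommGroup V] [Module ℂ V] [Module (Uq B b h) V]
    [IsScalarTower ℂ (Uq B b h) V] [AddCommGroup W] [Module ℂ W] [Module (Uq B b h) W]
    [IsScalarTower ℂ (Uq B b h) W] (g : V →ₗ[ℂ] W)
    (hK : ∀ m v, g (Uq.K B b h m • v) = Uq.K B b h m • g v)
    (hE : ∀ i v, g (Uq.E B b h i • v) = Uq.E B b h i • g v)
    (hF : ∀ i v, g (Uq.F B b h i • v) = Uq.F B b h i • g v) (x : Uq B b h) (v : V) :
    g (x • v) = x • g v := by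
  induction x using Uq.induction generalizing v with
  | hK m => exact hK m v
  | hE i => exact hE i v
  | hF i => exact hF i v
  | hC c => simp
  | hadd x y hx hy => rw [add_smul, map_add, hx, hy, add_smul]
  | hmul x y hx hy => rw [mul_smul, hx, hy, mul_smul]

/-- A subspace that is stable under the generators is a submodule. -/
def Uq.submoduleOfGenerators {V : Type*} [AddCommGroup V] [Module ℂ V] [Module (Uq B b h) V]
    [IsScalarTower ℂ (Uq B b h) V] (R : Submodule ℂ V)
    (hK : ∀ m, ∀ v ∈ R, Uq.K B b h m • v ∈ R) (hE : ∀ i, ∀ v ∈ R, Uq.E B b h i • v ∈ R)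
    (hF : ∀ i, ∀ v ∈ R, Uq.F B b h i • v ∈ R) : Submodule (Uq B b h) V where
  __ := R
  smul_mem' x v hv := by
    change x • v ∈ R
    replace hv : v ∈ R := hv
    induction x using Uq.induction generalizing v with
    | hK m => exact hK m v hv
    | hE i => exact hE i v hv
    | hF i => exact hF i v hv
    | hC c => rw [algebraMap_smul]; exact R.smul_mem c hv
    | hadd x y hx hy => rw [add_smul]; exact R.add_mem (hx v hv) (hy v hv)
    | hmul x y hx hy => rw [mul_smul]; exact hx _ (hy v hv)

/-! ### Rescaling automorphisms and the antipode -/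

variable (B b h)

/-- The relations are homogeneous for the grading with E_i in degree α_i, F_i in degree -α_i and K_m
in degree 0. -/
lemma satisfiesRel_scale {c : b.support → ℂ} (hc : ∀ i, c i ≠ 0) :
    SatisfiesRel B b h (Uq.K B b h) (fun i => c i • Uq.E B b h i)
      (fun i => (c i)⁻¹ • Uq.F B b h i) where
  k_zero := Uq.K_zero
  k_mul := Uq.K_mul
  k_e l j := by rw [mul_smul_comm, Uq.K_mul_E, smul_mul_assoc, smul_comm]
  k_f l j := by rw [mul_smul_comm, Uq.K_mul_F, smul_mul_assoc, smul_comm]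
  e_f_self i := by
    simp only [smul_mul_assoc, mul_smul_comm, smul_smul, mul_inv_cancel₀ (hc i),
      inv_mul_cancel₀ (hc i), one_smul, Uq.E_F_self]
  e_f_ne i j hij := by
    rw [smul_mul_smul_comm, smul_mul_smul_comm, mul_comm (c i), ← smul_sub, Uq.E_F_ne hij,
      smul_zero]
  serre_e i j hij := by rw [qSerre_smul_smul, Uq.serre_E hij, smul_zero]
  serre_f i j hij := by rw [qSerre_smul_smul, Uq.serre_F hij, smul_zero]

variable {b} in
/-- The automorphism of `U_q(𝔤)` that rescales `E_i` by `c_i` and `F_i` by `c_i⁻¹`. -/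
def Uq.scale {c : b.support → ℂ} (hc : ∀ i, c i ≠ 0) : Uq B b h →ₐ[ℂ] Uq B b h :=
  (satisfiesRel_scale B b h hc).lift

lemma Uq.scale_scale {c d : b.support → ℂ} (hc : ∀ i, c i ≠ 0) (hd : ∀ i, d i ≠ 0)
    (hcd : ∀ i, c i * d i = 1) (x : Uq B b h) : Uq.scale B h hc (Uq.scale B h hd x) = x := by
  have : (Uq.scale B h hc).comp (Uq.scale B h hd) = AlgHom.id ℂ _ := by
    refine Uq.algHom_ext ?_ ?_ ?_
    · intro m; simp [Uq.scale]
    · intro i; simp [Uq.scale, smul_smul, mul_comm (d i), hcd]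
    · intro i; simp [Uq.scale, smul_smul, ← mul_inv, mul_comm (d i), hcd]
  exact DFunLike.congr_fun this x

-- The values -E_i K_i⁻¹ and -K_i F_i are those forced by the antipode axiom for the given
-- comultiplication. The Serre relations follow by combining `qSerre_op` with `qSerre_mul_right`.
open MulOpposite in
lemma satisfiesRel_antipode [Finite ι] :
    SatisfiesRel B b h (fun m => op (Uq.K B b h (-m)))
      (fun i => op (-(Uq.E B b h i * Uq.K B b h (-simpleRoot B b i))))
      (fun i => op (-(Uq.K B b h (simpleRoot B b i) * Uq.F B b h i))) := by
  have hKE : ∀ (m : weightLattice B b) (j : b.support), Uq.K B b h (-m) * Uq.E B b h j =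
      (qForm B h m (P.root j))⁻¹ • (Uq.E B b h j * Uq.K B b h (-m)) := fun m j => by
    rw [Uq.K_mul_E, AddSubgroup.coe_neg, qForm_neg_left]
  have hKF : ∀ (m : weightLattice B b) (j : b.support), Uq.K B b h (-m) * Uq.F B b h j =
      qForm B h m (P.root j) • (Uq.F B b h j * Uq.K B b h (-m)) := fun m j => by
    rw [Uq.K_mul_F, AddSubgroup.coe_neg, qForm_neg_left, inv_inv]
  have hEK : ∀ (m : weightLattice B b) (j : b.support), Uq.E B b h j * Uq.K B b h (-m) =
      qForm B h m (P.root j) • (Uq.K B b h (-m) * Uq.E B b h j) := fun m j => by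
    rw [hKE, smul_smul, mul_inv_cancel₀ (qForm_ne_zero B h _ _), one_smul]
  have hFK : ∀ (m : weightLattice B b) (j : b.support), Uq.F B b h j * Uq.K B b h (-m) =
      (qForm B h m (P.root j))⁻¹ • (Uq.K B b h (-m) * Uq.F B b h j) := fun m j => by
    rw [hKF, smul_smul, inv_mul_cancel₀ (qForm_ne_zero B h _ _), one_smul]
  refine ⟨?_, ?_, ?_, ?_, ?_, ?_, ?_, ?_⟩
  · simp [Uq.K_zero]
  · intro l m
    rw [← op_mul, Uq.K_mul, neg_add_rev]
  · intro l j
    rw [← op_mul, ← op_mul, ← op_smul, neg_mul, mul_neg, mul_assoc, Uq.K_comm, ← mul_assoc, hEK,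
      smul_mul_assoc, mul_assoc, smul_neg]
  · intro l j
    rw [← op_mul, ← op_mul, ← op_smul, neg_mul, mul_neg, mul_assoc, hFK, mul_smul_comm, ← mul_assoc,
      Uq.K_comm, mul_assoc, smul_neg]
  · intro i
    have e : Uq.K B b h (simpleRoot B b i) * Uq.F B b h i *
        (Uq.E B b h i * Uq.K B b h (-simpleRoot B b i)) = Uq.F B b h i * Uq.E B b h i := by
      rw [Uq.K_mul_F, smul_mul_assoc, mul_assoc, ← mul_assoc (Uq.K B b h _), Uq.K_mul_E,
        smul_mul_assoc, mul_assoc (Uq.E B b h i), Uq.K_mul_neg, mul_one, mul_smul_comm, smul_smul,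
        inv_mul_cancel₀ (qForm_ne_zero B h _ _), one_smul]
    have e' : Uq.E B b h i * Uq.K B b h (-simpleRoot B b i) *
        (Uq.K B b h (simpleRoot B b i) * Uq.F B b h i) = Uq.E B b h i * Uq.F B b h i := by
      rw [mul_assoc, ← mul_assoc (Uq.K B b h _), Uq.K_neg_mul, one_mul]
    rw [← op_mul, ← op_mul, neg_mul_neg, neg_mul_neg, e, e', ← op_sub, ← op_sub, ← op_smul,
      ← neg_sub (Uq.E B b h i * _), Uq.E_F_self, neg_neg, ← smul_neg, neg_sub]
  · intro i j hij
    have h1 := sub_eq_zero.mp (Uq.E_F_ne (B := B) (h := h) hij)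
    have e : Uq.K B b h (simpleRoot B b j) * Uq.F B b h j *
        (Uq.E B b h i * Uq.K B b h (-simpleRoot B b i)) =
        (Uq.E B b h i * Uq.K B b h (-simpleRoot B b i)) *
          (Uq.K B b h (simpleRoot B b j) * Uq.F B b h j) := by
      -- The scalars from moving K_j past E_i and K_i⁻¹ past F_j are mutually inverse because the
      -- form is symmetric.
      have hc : qForm B h (P.root j) (P.root i) * (qForm B h (P.root i) (P.root j))⁻¹ = 1 := by
        rw [qForm_symm, mul_inv_cancel₀ (qForm_ne_zero B h _ _)]
      rw [mul_assoc, ← mul_assoc (Uq.F B b h j), ← h1, mul_assoc (Uq.E B b h i), hFK,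
        mul_smul_comm, mul_smul_comm, ← mul_assoc, Uq.K_mul_E, smul_mul_assoc, smul_smul, mul_comm,
        mul_assoc (Uq.E B b h i), ← mul_assoc (Uq.K B b h _), Uq.K_comm]
      simp only [mul_assoc]
      exact (congrArg (· • _) hc).trans (one_smul _ _)
    rw [← op_mul, ← op_mul, neg_mul_neg, neg_mul_neg, e, sub_self]
  · intro i j hij
    obtain ⟨m, hm, hf⟩ := exists_serreExp B b h hij
    have hs := Uq.serre_E (B := B) (h := h) hij
    rw [hm] at hs ⊢
    rw [qSerre_op, ← neg_one_smul ℂ (Uq.E B b h i * _), ← neg_one_smul ℂ (Uq.E B b h j * _),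
      qSerre_smul_smul, qSerre_mul_right (qRoot_ne_zero B b h i) (qInt_qRoot_ne_zero B b h i)
        (hKE _ _) (hKE _ _) ?_ (Uq.K_comm _ _) hs]
    · simp
    · rw [hKE]
      exact congrArg (fun t => t⁻¹ • _) (qForm_symm B h _ _)
  · intro i j hij
    obtain ⟨m, hm, hf⟩ := exists_serreExp B b h hij
    have hs := Uq.serre_F (B := B) (h := h) hij
    rw [hm] at hs ⊢
    -- K_i F_i is first rewritten as a multiple of F_i K_i, the shape that `qSerre_mul_right`
    -- requires.
    rw [Uq.K_mul_F, Uq.K_mul_F, qSerre_op, ← neg_one_smul ℂ ((qForm B h _ (P.root i))⁻¹ • _),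
      ← neg_one_smul ℂ ((qForm B h _ (P.root j))⁻¹ • _), smul_smul, smul_smul,
      qSerre_smul_smul, qSerre_mul_right (qRoot_ne_zero B b h i) (qInt_qRoot_ne_zero B b h i)
        (Uq.K_mul_F _ _) (Uq.K_mul_F _ _) ?_ (Uq.K_comm _ _) hs]
    · simp
    · rw [Uq.K_mul_F]
      exact congrArg (fun t => t⁻¹ • _) (qForm_symm B h _ _)

/-- The antipode of `U_q(𝔤)`, as a homomorphism to the opposite algebra. -/
def Uq.antipode [Finite ι] : Uq B b h →ₐ[ℂ] (Uq B b h)ᵐᵒᵖ := (satisfiesRel_antipode B b h).lift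

/-- The inverse of the antipode of `U_q(𝔤)`, as a homomorphism to the opposite algebra. -/
def Uq.antipodeInv [Finite ι] : Uq B b h →ₐ[ℂ] (Uq B b h)ᵐᵒᵖ :=
  -- The square of the antipode S fixes K_m and rescales E_i by q^(α_i,α_i) and F_i by the inverse,
  -- so S⁻¹ is S preceded by the inverse rescaling.
  (Uq.antipode B b h).comp
    (Uq.scale B h (c := fun i => (qForm B h (P.root i) (P.root i))⁻¹)
      fun _ => inv_ne_zero (qForm_ne_zero B h _ _))

open MulOpposite

@[simp] lemma Uq.antipode_K [Finite ι] (m : weightLattice B b) :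
    Uq.antipode B b h (Uq.K B b h m) = op (Uq.K B b h (-m)) :=
  SatisfiesRel.lift_K _ _

@[simp] lemma Uq.antipode_E [Finite ι] (i : b.support) : Uq.antipode B b h (Uq.E B b h i) =
    op (-(Uq.E B b h i * Uq.K B b h (-simpleRoot B b i))) :=
  SatisfiesRel.lift_E _ _

@[simp] lemma Uq.antipode_F [Finite ι] (i : b.support) : Uq.antipode B b h (Uq.F B b h i) =
    op (-(Uq.K B b h (simpleRoot B b i) * Uq.F B b h i)) :=
  SatisfiesRel.lift_F _ _

@[simp] lemma Uq.antipodeInv_K [Finite ι] (m : weightLattice B b) :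
    Uq.antipodeInv B b h (Uq.K B b h m) = op (Uq.K B b h (-m)) := by
  simp [Uq.antipodeInv, Uq.scale]

@[simp] lemma Uq.antipodeInv_E [Finite ι] (i : b.support) :
    Uq.antipodeInv B b h (Uq.E B b h i) =
      op (-(Uq.K B b h (-simpleRoot B b i) * Uq.E B b h i)) := by
  have := Uq.K_mul_E (h := h) (-simpleRoot B b i) i
  rw [AddSubgroup.coe_neg, qForm_neg_left] at this
  rw [this]
  simp [Uq.antipodeInv, Uq.scale]
  rfl

@[simp] lemma Uq.antipodeInv_F [Finite ι] (i : b.support) :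
    Uq.antipodeInv B b h (Uq.F B b h i) =
      op (-(Uq.F B b h i * Uq.K B b h (simpleRoot B b i))) := by
  have := Uq.K_mul_F (h := h) (simpleRoot B b i) i
  have h0 := qForm_ne_zero B h (P.root i) (P.root i)
  simp [Uq.antipodeInv, Uq.scale, this, smul_smul]
  simp [simpleRoot, h0]

end Lift

/-! ### Verma modules, tensor products and actions on spaces of linear maps -/

section Frobenius

variable {ι M N : Type*} [AddCommGroup M] [Module ℂ M] [AddCommGroup N] [Module ℂ N]
  {P : RootPairing ι ℂ M N} [P.IsCrystallographic]
  {B : P.RootPositiveForm ℝ} {b : P.Base} {h : ℝˣ}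

/-- The universal property of Verma modules. -/
lemma Verma.exists_lift {l : QWeight B b h} {Y : Type*} [AddCommGroup Y] [Module ℂ Y]
    (ρ : Uq B b h →ₐ[ℂ] Module.End ℂ Y) (y : Y) (hE : ∀ i, ρ (Uq.E B b h i) y = 0)
    (hK : ∀ m, ρ (Uq.K B b h m) y = l.eval B b h m • y) :
    ∃ g : Verma B b h l →ₗ[ℂ] Y, g (Verma.hwVector B b h l) = y ∧
      ∀ x v, g (x • v) = ρ x (g v) := by
  -- The action comes from `ρ`, as spaces of linear maps will be used with actions other than the
  -- one through their target.
  let _ : Module (Uq B b h) Y := Module.compHom Y ρ.toRingHom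
  have hs : ∀ (x : Uq B b h) (y : Y), x • y = ρ x y := fun _ _ => rfl
  have : IsScalarTower ℂ (Uq B b h) Y := ⟨fun c x y => by simp [hs]⟩
  have hle : vermaIdeal B b h l ≤ LinearMap.ker (LinearMap.toSpanSingleton (Uq B b h) Y y) := by
    refine Submodule.span_le.mpr ?_
    rintro _ (⟨i, rfl⟩ | ⟨m, rfl⟩)
    · simpa [hs] using hE i
    · simp [hs, hK m]
  refine ⟨((vermaIdeal B b h l).liftQ _ hle).restrictScalars ℂ, ?_, ?_⟩
  · simp [Verma.hwVector]
  · intro x v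
    rw [← hs]
    exact LinearMap.map_smul ((vermaIdeal B b h l).liftQ _ hle) x v

lemma Verma.E_smul_hwVector (l : QWeight B b h) (i : b.support) :
    Uq.E B b h i • Verma.hwVector B b h l = 0 := by
  rw [Verma.hwVector, ← Submodule.Quotient.mk_smul, Submodule.Quotient.mk_eq_zero, smul_eq_mul,
    mul_one]
  exact Submodule.subset_span (Or.inl ⟨i, rfl⟩)

lemma Verma.K_smul_hwVector (l : QWeight B b h) (m : weightLattice B b) :
    Uq.K B b h m • Verma.hwVector B b h l = l.eval B b h m • Verma.hwVector B b h l := by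
  rw [← sub_eq_zero, ← algebraMap_smul (Uq B b h) (l.eval B b h m), ← sub_smul, Verma.hwVector,
    ← Submodule.Quotient.mk_smul, Submodule.Quotient.mk_eq_zero, smul_eq_mul, mul_one]
  exact Submodule.subset_span (Or.inr ⟨m, rfl⟩)

lemma Verma.span_hwVector (l : QWeight B b h) :
    Submodule.span (Uq B b h) {Verma.hwVector B b h l} = ⊤ := by
  rw [eq_top_iff]
  rintro v -
  obtain ⟨x, rfl⟩ := Submodule.Quotient.mk_surjective _ v
  refine Submodule.mem_span_singleton.mpr ⟨x, ?_⟩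
  rw [Verma.hwVector, ← Submodule.Quotient.mk_smul, smul_eq_mul, mul_one]

lemma Uq.K_smul_K_neg_smul {V : Type*} [AddCommGroup V] [Module (Uq B b h) V]
    (m : weightLattice B b) (v : V) :
    Uq.K B b h m • Uq.K B b h (-m) • v = v := by
  rw [← mul_smul, Uq.K_mul_neg, one_smul]

lemma Uq.K_neg_smul_K_smul {V : Type*} [AddCommGroup V] [Module (Uq B b h) V]
    (m : weightLattice B b) (v : V) :
    Uq.K B b h (-m) • Uq.K B b h m • v = v := by
  rw [← mul_smul, Uq.K_neg_mul, one_smul]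

/-- The algebra homomorphism `x ↦ (f ↦ f ∘ S(x))` attached to an antihomomorphism `S`. -/
def precomp (V X : Type*) [AddCommGroup V] [Module ℂ V] [Module (Uq B b h) V]
    [IsScalarTower ℂ (Uq B b h) V] [AddCommGroup X] [Module ℂ X]
    (S : Uq B b h →ₐ[ℂ] (Uq B b h)ᵐᵒᵖ) : Uq B b h →ₐ[ℂ] Module.End ℂ (V →ₗ[ℂ] X) :=
  AlgHom.ofLinearMap
    { toFun := fun x => LinearMap.lcomp ℂ X (Algebra.lsmul ℂ ℂ V (S x).unop)
      map_add' := fun x y => by ext f v; simp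
      map_smul' := fun c x => by ext f v; simp }
    (by ext f v; simp)
    (fun x y => by ext f v; simp)

lemma precomp_apply {V X : Type*} [AddCommGroup V] [Module ℂ V]
    [Module (Uq B b h) V] [IsScalarTower ℂ (Uq B b h) V] [AddCommGroup X] [Module ℂ X]
    (S : Uq B b h →ₐ[ℂ] (Uq B b h)ᵐᵒᵖ) (x : Uq B b h) (f : V →ₗ[ℂ] X) (v : V) :
    precomp V X S x f v = f ((S x).unop • v) := rfl

variable {V : Type*} [AddCommGroup V] [Module ℂ V] [Module (Uq B b h) V]
  [IsScalarTower ℂ (Uq B b h) V] {W : Type*} [AddCommGroup W] [Module ℂ W] [Module (Uq B b h) W]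
  [IsScalarTower ℂ (Uq B b h) W] {X : Type*} [AddCommGroup X] [Module ℂ X]
  [Module (Uq B b h) X] [IsScalarTower ℂ (Uq B b h) X]

lemma commute_lsmul_precomp (S : Uq B b h →ₐ[ℂ] (Uq B b h)ᵐᵒᵖ) (x y : Uq B b h) :
    Commute (Algebra.lsmul ℂ ℂ (V →ₗ[ℂ] X) x) (precomp V X S y) :=
  LinearMap.ext fun f => LinearMap.ext fun v => by simp [precomp_apply]

namespace UqTensor

/-- The pure tensor `v ⊗ w`. -/
def tmul (v : V) (w : W) : UqTensor B b h V W := (v ⊗ₜ[ℂ] w : V ⊗[ℂ] W)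

/-- The bilinear map `(v, w) ↦ v ⊗ w`. -/
def mk (V W : Type*) [AddCommGroup V] [Module ℂ V] [Module (Uq B b h) V]
    [IsScalarTower ℂ (Uq B b h) V] [AddCommGroup W] [Module ℂ W] [Module (Uq B b h) W]
    [IsScalarTower ℂ (Uq B b h) W] : V →ₗ[ℂ] W →ₗ[ℂ] UqTensor B b h V W := TensorProduct.mk ℂ V W

@[simp] lemma mk_apply (v : V) (w : W) : mk (B := B) (b := b) (h := h) V W v w = tmul v w := rfl

/-- The linear map on a tensor product that is attached to a bilinear map. -/
def lift {Y : Type*} [AddCommGroup Y] [Module ℂ Y] (f : V →ₗ[ℂ] W →ₗ[ℂ] Y) :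
    UqTensor B b h V W →ₗ[ℂ] Y := TensorProduct.lift f

@[simp] lemma lift_tmul {Y : Type*} [AddCommGroup Y] [Module ℂ Y] (f : V →ₗ[ℂ] W →ₗ[ℂ] Y)
    (v : V) (w : W) : lift f (tmul v w : UqTensor B b h V W) = f v w :=
  TensorProduct.lift.tmul v w

lemma ext {Y : Type*} [AddCommGroup Y] [Module ℂ Y] {f g : UqTensor B b h V W →ₗ[ℂ] Y}
    (H : ∀ v w, f (tmul v w) = g (tmul v w)) : f = g :=
  TensorProduct.ext' H

lemma tmul_smul (c : ℂ) (v : V) (w : W) :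
    (tmul v (c • w) : UqTensor B b h V W) = c • tmul v w := TensorProduct.tmul_smul c v w

lemma smul_tmul (c : ℂ) (v : V) (w : W) :
    (tmul (c • v) w : UqTensor B b h V W) = c • tmul v w := rfl

@[simp] lemma tmul_zero (v : V) : (tmul v 0 : UqTensor B b h V W) = 0 :=
  TensorProduct.tmul_zero W v

@[simp] lemma zero_tmul (w : W) : (tmul 0 w : UqTensor B b h V W) = 0 :=
  TensorProduct.zero_tmul V w

lemma span_tmul : Submodule.span ℂ {t : UqTensor B b h V W | ∃ v w, tmul v w = t} = ⊤ :=
  TensorProduct.span_tmul_eq_top ℂ V W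

end UqTensor

variable [Finite ι]

/-- The action `x ↦ (f ↦ ∑ x₍₁₎ ∘ f ∘ S(x₍₂₎))` of `U_q(𝔤)` on linear maps. -/
def homAction (V X : Type*) [AddCommGroup V] [Module ℂ V] [Module (Uq B b h) V]
    [IsScalarTower ℂ (Uq B b h) V] [AddCommGroup X] [Module ℂ X] [Module (Uq B b h) X]
    [IsScalarTower ℂ (Uq B b h) X] : Uq B b h →ₐ[ℂ] Module.End ℂ (V →ₗ[ℂ] X) :=
  (Algebra.TensorProduct.lift (Algebra.lsmul ℂ ℂ (V →ₗ[ℂ] X)) (precomp V X (Uq.antipode B b h))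
    (commute_lsmul_precomp _)).comp (Uq.comul B b h)

/-- The action `x ↦ (f ↦ ∑ x₍₂₎ ∘ f ∘ S⁻¹(x₍₁₎))` of `U_q(𝔤)` on linear maps. -/
def homActionInv (V X : Type*) [AddCommGroup V] [Module ℂ V] [Module (Uq B b h) V]
    [IsScalarTower ℂ (Uq B b h) V] [AddCommGroup X] [Module ℂ X] [Module (Uq B b h) X]
    [IsScalarTower ℂ (Uq B b h) X] : Uq B b h →ₐ[ℂ] Module.End ℂ (V →ₗ[ℂ] X) :=
  (Algebra.TensorProduct.lift (precomp V X (Uq.antipodeInv B b h)) (Algebra.lsmul ℂ ℂ (V →ₗ[ℂ] X))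
    fun x y => (commute_lsmul_precomp _ y x).symm).comp (Uq.comul B b h)

lemma homAction_K (m : weightLattice B b) (f : V →ₗ[ℂ] X) (v : V) :
    homAction V X (Uq.K B b h m) f v = Uq.K B b h m • f (Uq.K B b h (-m) • v) := by
  simp [homAction, precomp_apply]

lemma homAction_E (i : b.support) (f : V →ₗ[ℂ] X) (v : V) :
    homAction V X (Uq.E B b h i) f v =
      Uq.E B b h i • f (Uq.K B b h (-simpleRoot B b i) • v) -
        f (Uq.E B b h i • Uq.K B b h (-simpleRoot B b i) • v) := by
  simp [homAction, precomp_apply, mul_smul, sub_eq_add_neg]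

lemma homAction_F (i : b.support) (f : V →ₗ[ℂ] X) (v : V) :
    homAction V X (Uq.F B b h i) f v = Uq.F B b h i • f v -
      Uq.K B b h (-simpleRoot B b i) • f (Uq.K B b h (simpleRoot B b i) • Uq.F B b h i • v) := by
  simp [homAction, precomp_apply, mul_smul, sub_eq_add_neg]

lemma homActionInv_K (m : weightLattice B b) (f : V →ₗ[ℂ] X) (v : V) :
    homActionInv V X (Uq.K B b h m) f v = Uq.K B b h m • f (Uq.K B b h (-m) • v) := by
  simp [homActionInv, precomp_apply]

lemma homActionInv_E (i : b.support) (f : V →ₗ[ℂ] X) (v : V) :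
    homActionInv V X (Uq.E B b h i) f v = Uq.E B b h i • f v -
      Uq.K B b h (simpleRoot B b i) • f (Uq.K B b h (-simpleRoot B b i) • Uq.E B b h i • v) := by
  simp [homActionInv, precomp_apply, mul_smul, sub_eq_add_neg, add_comm]

lemma homActionInv_F (i : b.support) (f : V →ₗ[ℂ] X) (v : V) :
    homActionInv V X (Uq.F B b h i) f v =
      Uq.F B b h i • f (Uq.K B b h (simpleRoot B b i) • v) -
        f (Uq.F B b h i • Uq.K B b h (simpleRoot B b i) • v) := by
  simp [homActionInv, precomp_apply, mul_smul, sub_eq_add_neg, add_comm]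

namespace UqTensor

lemma K_smul (m : weightLattice B b) (v : V) (w : W) :
    Uq.K B b h m • (tmul v w : UqTensor B b h V W) = tmul (Uq.K B b h m • v) (Uq.K B b h m • w) := by
  refine (smul_def B b h V W _ _).trans ?_
  simp only [action, tmul, AlgHom.comp_apply, Uq.comul_K, Algebra.TensorProduct.map_tmul]
  rfl

lemma E_smul (i : b.support) (v : V) (w : W) :
    Uq.E B b h i • (tmul v w : UqTensor B b h V W) =
      tmul (Uq.E B b h i • v) (Uq.K B b h (simpleRoot B b i) • w) + tmul v (Uq.E B b h i • w) := by
  refine (smul_def B b h V W _ _).trans ?_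
  simp [action]
  rfl

lemma F_smul (i : b.support) (v : V) (w : W) :
    Uq.F B b h i • (tmul v w : UqTensor B b h V W) =
      tmul (Uq.F B b h i • v) w + tmul (Uq.K B b h (-simpleRoot B b i) • v) (Uq.F B b h i • w) := by
  refine (smul_def B b h V W _ _).trans ?_
  simp [action]
  rfl

/-- A linear map from a tensor product that commutes with the generators of `U_q(𝔤)` on pure
tensors is `U_q(𝔤)`-linear. -/
lemma map_smul_of_tmul (g : UqTensor B b h V W →ₗ[ℂ] X)
    (hK : ∀ m v w, g (Uq.K B b h m • tmul v w) = Uq.K B b h m • g (tmul v w))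
    (hE : ∀ i v w, g (Uq.E B b h i • tmul v w) = Uq.E B b h i • g (tmul v w))
    (hF : ∀ i v w, g (Uq.F B b h i • tmul v w) = Uq.F B b h i • g (tmul v w)) (x : Uq B b h)
    (t : UqTensor B b h V W) : g (x • t) = x • g t := by
  have key : ∀ y : Uq B b h, (∀ v w, g (y • tmul v w) = y • g (tmul v w)) →
      ∀ t, g (y • t) = y • g t := fun y hy t => by
    have : g ∘ₗ Algebra.lsmul ℂ ℂ _ y = Algebra.lsmul ℂ ℂ _ y ∘ₗ g := ext hy
    exact DFunLike.congr_fun this t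
  exact Uq.map_smul_of_generators g (fun m => key _ (hK m)) (fun i => key _ (hE i))
    (fun i => key _ (hF i)) x t

end UqTensor

/-! ### Frobenius reciprocity and the comparison of the two tensor products -/

open UqTensor

/-- Frobenius reciprocity for `M(λ) ⊗ V`. -/
lemma exists_lift_verma_tensor {l : QWeight B b h} (f : V →ₗ[ℂ] X)
    (hE : ∀ i v, f (Uq.E B b h i • v) = Uq.E B b h i • f v)
    (hK : ∀ m v, l.eval B b h m • f (Uq.K B b h m • v) = Uq.K B b h m • f v) :
    ∃ g : UqTensor B b h (Verma B b h l) V →ₗ[Uq B b h] X,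
      ∀ v, g (tmul (Verma.hwVector B b h l) v) = f v := by
  -- By currying, a U_q(g)-map M(l) ⊗ V → X is a U_q(g)-map from M(l) to the linear maps V → X with
  -- `homAction`. The hypotheses say that f is killed by all E_i and has weight l there.
  obtain ⟨g, hg, hg'⟩ := Verma.exists_lift (l := l) (homAction V X) f
    (fun i => by ext v; simp [homAction_E, hE])
    (fun m => by ext v; simp [homAction_K, ← hK, Uq.K_smul_K_neg_smul])
  refine ⟨⟨(UqTensor.lift g).toAddHom, map_smul_of_tmul (UqTensor.lift g) ?_ ?_ ?_⟩, fun v => ?_⟩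
  · intro m x v
    simp [UqTensor.K_smul, hg', homAction_K, Uq.K_neg_smul_K_smul]
  · intro i x v
    simp [UqTensor.E_smul, hg', homAction_E, Uq.K_neg_smul_K_smul]
  · intro i x v
    have h1 : ∀ v, g (Uq.K B b h (-simpleRoot B b i) • x) v = _ := fun v => by
      rw [hg', homAction_K, neg_neg]
    simp [UqTensor.F_smul, hg', homAction_F, homAction_K]
  · exact (UqTensor.lift_tmul g _ v).trans (by rw [hg])

/-- Frobenius reciprocity for `V ⊗ M(λ)`. -/
lemma exists_lift_tensor_verma {l : QWeight B b h} (f : V →ₗ[ℂ] X)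
    (hE : ∀ i v, l.eval B b h (simpleRoot B b i) • f (Uq.E B b h i • v) = Uq.E B b h i • f v)
    (hK : ∀ m v, l.eval B b h m • f (Uq.K B b h m • v) = Uq.K B b h m • f v) :
    ∃ g : UqTensor B b h V (Verma B b h l) →ₗ[Uq B b h] X,
      ∀ v, g (tmul v (Verma.hwVector B b h l)) = f v := by
  -- With V on the left, currying requires S⁻¹. The term K_i f(K_i⁻¹ E_i v) equals q^(l,α_i) f(E_i
  -- v) by `hK`, which is where the scalar in `hE` comes from.
  obtain ⟨g, hg, hg'⟩ := Verma.exists_lift (l := l) (homActionInv V X) f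
    (fun i => by ext v; simp [homActionInv_E, ← hK, hE, Uq.K_smul_K_neg_smul])
    (fun m => by ext v; simp [homActionInv_K, ← hK, Uq.K_smul_K_neg_smul])
  refine ⟨⟨(UqTensor.lift g.flip).toAddHom, map_smul_of_tmul (UqTensor.lift g.flip) ?_ ?_ ?_⟩,
    fun v => ?_⟩
  · intro m v x
    simp [UqTensor.K_smul, hg', homActionInv_K, Uq.K_neg_smul_K_smul]
  · intro i v x
    simp [UqTensor.E_smul, hg', homActionInv_E, homActionInv_K]
  · intro i v x
    simp [UqTensor.F_smul, hg', homActionInv_F, Uq.K_smul_K_neg_smul]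
  · exact (UqTensor.lift_tmul g.flip v _).trans (by rw [LinearMap.flip_apply, hg])

/-- The x with x ⊗ V inside R form a submodule of M(l): when a generator is applied to x ⊗ v, the
unwanted summand of the coproduct already lies in R, and v is arbitrary, so factors K_i⁻¹ can be
undone. This submodule contains the generator of M(l). -/
lemma span_hwVector_tmul (l : QWeight B b h) (R : Submodule (Uq B b h)
    (UqTensor B b h (Verma B b h l) V)) (hR : ∀ v, tmul (Verma.hwVector B b h l) v ∈ R) :
    R = ⊤ := by
  let R' : Submodule ℂ (Verma B b h l) :=
    ⨅ v : V, (R.restrictScalars ℂ).comap ((UqTensor.mk (Verma B b h l) V).flip v)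
  have hR' : ∀ x, x ∈ R' ↔ ∀ v, tmul x v ∈ R := fun x => by
    simp only [R', Submodule.mem_iInf]
    rfl
  have hK : ∀ m, ∀ x ∈ R', Uq.K B b h m • x ∈ R' := fun m x hx => (hR' _).mpr fun v => by
    have := R.smul_mem (Uq.K B b h m) ((hR' x).mp hx (Uq.K B b h (-m) • v))
    rwa [UqTensor.K_smul, Uq.K_smul_K_neg_smul] at this
  let R'' := Uq.submoduleOfGenerators R' hK
    (fun i x hx => (hR' _).mpr fun v => by
      have h1 := R.smul_mem (Uq.E B b h i) ((hR' x).mp hx (Uq.K B b h (-simpleRoot B b i) • v))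
      have h2 := (hR' x).mp hx (Uq.E B b h i • Uq.K B b h (-simpleRoot B b i) • v)
      rw [UqTensor.E_smul, Uq.K_smul_K_neg_smul] at h1
      exact (R.add_mem_iff_left h2).mp h1)
    (fun i x hx => (hR' _).mpr fun v => by
      have h1 := R.smul_mem (Uq.F B b h i) ((hR' x).mp hx v)
      have h2 := (hR' _).mp (hK (-simpleRoot B b i) x hx) (Uq.F B b h i • v)
      rw [UqTensor.F_smul] at h1
      exact (R.add_mem_iff_left h2).mp h1)
  have htop : R'' = ⊤ := by
    rw [eq_top_iff, ← Verma.span_hwVector, Submodule.span_le, Set.singleton_subset_iff]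
    exact (hR' _).mpr hR
  rw [← Submodule.restrictScalars_eq_top_iff ℂ, eq_top_iff, ← UqTensor.span_tmul, Submodule.span_le]
  rintro _ ⟨x, v, rfl⟩
  have : x ∈ R'' := htop ▸ Submodule.mem_top
  exact (hR' x).mp this v

/-- Mirror image of `span_hwVector_tmul`; now the E-step rather than the F-step relies on stability
under the K_m. -/
lemma span_tmul_hwVector (l : QWeight B b h) (R : Submodule (Uq B b h)
    (UqTensor B b h V (Verma B b h l))) (hR : ∀ v, tmul v (Verma.hwVector B b h l) ∈ R) :
    R = ⊤ := by
  let R' : Submodule ℂ (Verma B b h l) :=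
    ⨅ v : V, (R.restrictScalars ℂ).comap (UqTensor.mk V (Verma B b h l) v)
  have hR' : ∀ x, x ∈ R' ↔ ∀ v, tmul v x ∈ R := fun x => by
    simp only [R', Submodule.mem_iInf]
    rfl
  have hK : ∀ m, ∀ x ∈ R', Uq.K B b h m • x ∈ R' := fun m x hx => (hR' _).mpr fun v => by
    have := R.smul_mem (Uq.K B b h m) ((hR' x).mp hx (Uq.K B b h (-m) • v))
    rwa [UqTensor.K_smul, Uq.K_smul_K_neg_smul] at this
  let R'' := Uq.submoduleOfGenerators R' hK
    (fun i x hx => (hR' _).mpr fun v => by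
      have h1 := R.smul_mem (Uq.E B b h i) ((hR' x).mp hx v)
      have h2 := (hR' _).mp (hK (simpleRoot B b i) x hx) (Uq.E B b h i • v)
      rw [UqTensor.E_smul] at h1
      exact (R.add_mem_iff_right h2).mp h1)
    (fun i x hx => (hR' _).mpr fun v => by
      have h1 := R.smul_mem (Uq.F B b h i) ((hR' x).mp hx (Uq.K B b h (simpleRoot B b i) • v))
      have h2 := (hR' x).mp hx (Uq.F B b h i • Uq.K B b h (simpleRoot B b i) • v)
      rw [UqTensor.F_smul, Uq.K_neg_smul_K_smul] at h1
      exact (R.add_mem_iff_right h2).mp h1)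
  have htop : R'' = ⊤ := by
    rw [eq_top_iff, ← Verma.span_hwVector, Submodule.span_le, Set.singleton_subset_iff]
    exact (hR' _).mpr hR
  rw [← Submodule.restrictScalars_eq_top_iff ℂ, eq_top_iff, ← UqTensor.span_tmul, Submodule.span_le]
  rintro _ ⟨v, x, rfl⟩
  have : x ∈ R'' := htop ▸ Submodule.mem_top
  exact (hR' x).mp this v

/-- If `D` is an automorphism of the vector space `V` that commutes with all `K_μ` and satisfies
`D E_i = q ^ (λ, α_i) E_i D`, then `V ⊗ M(λ)` and `M(λ) ⊗ V` are isomorphic. -/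
lemma nonempty_tensor_verma_equiv (l : QWeight B b h) (D : V ≃ₗ[ℂ] V)
    (hE : ∀ i v, D (Uq.E B b h i • v) = l.eval B b h (simpleRoot B b i) • Uq.E B b h i • D v)
    (hK : ∀ m v, D (Uq.K B b h m • v) = Uq.K B b h m • D v) :
    Nonempty (UqTensor B b h V (Verma B b h l) ≃ₗ[Uq B b h] UqTensor B b h (Verma B b h l) V) := by
  have hE' : ∀ i v, l.eval B b h (simpleRoot B b i) • D.symm (Uq.E B b h i • v) =
      Uq.E B b h i • D.symm v := fun i v => by
    rw [← map_smul, LinearEquiv.symm_apply_eq, hE, LinearEquiv.apply_symm_apply]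
  have hK' : ∀ m v, D.symm (Uq.K B b h m • v) = Uq.K B b h m • D.symm v := fun m v => by
    rw [LinearEquiv.symm_apply_eq, hK, LinearEquiv.apply_symm_apply]
  -- Φ extends v_l ⊗ v ↦ D v ⊗ v_l; the scalar that K_i produces on v_l is the one in the
  -- commutation rule of D with E_i.
  obtain ⟨Φ, hΦ⟩ := exists_lift_verma_tensor (l := l) (V := V) (X :=
    UqTensor B b h V (Verma B b h l))
    ((UqTensor.mk V (Verma B b h l)).flip (Verma.hwVector B b h l) ∘ₗ D.toLinearMap)
    (fun i v => by
      change tmul (D (Uq.E B b h i • v)) _ = Uq.E B b h i • tmul (D v) _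
      rw [UqTensor.E_smul, Verma.E_smul_hwVector, Verma.K_smul_hwVector, tmul_zero, hE, tmul_smul,
        add_zero, smul_tmul])
    (fun m v => by
      change _ • tmul (D (Uq.K B b h m • v)) _ = Uq.K B b h m • tmul (D v) _
      rw [UqTensor.K_smul, Verma.K_smul_hwVector, hK, tmul_smul])
  obtain ⟨Ψ, hΨ⟩ := exists_lift_tensor_verma (l := l) (V := V) (X :=
    UqTensor B b h (Verma B b h l) V)
    (UqTensor.mk (Verma B b h l) V (Verma.hwVector B b h l) ∘ₗ D.symm.toLinearMap)
    (fun i v => by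
      change _ • tmul _ (D.symm (Uq.E B b h i • v)) = Uq.E B b h i • tmul _ (D.symm v)
      rw [UqTensor.E_smul, Verma.E_smul_hwVector, zero_tmul, zero_add, ← hE', tmul_smul])
    (fun m v => by
      change _ • tmul _ (D.symm (Uq.K B b h m • v)) = Uq.K B b h m • tmul _ (D.symm v)
      rw [UqTensor.K_smul, Verma.K_smul_hwVector, hK', smul_tmul])
  replace hΦ : ∀ v, Φ (tmul (Verma.hwVector B b h l) v) = tmul (D v) (Verma.hwVector B b h l) := hΦ
  replace hΨ : ∀ v, Ψ (tmul v (Verma.hwVector B b h l)) = tmul (Verma.hwVector B b h l) (D.symm v) :=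
    hΨ
  -- Each composite agrees with the identity on a submodule, which contains the generating tensors.
  refine ⟨LinearEquiv.ofLinearMap Ψ Φ ?_ ?_⟩
  · rw [← LinearMap.eqLocus_eq_top]
    exact span_hwVector_tmul l _ fun v => by simp [LinearMap.mem_eqLocus, hΦ, hΨ]
  · rw [← LinearMap.eqLocus_eq_top]
    exact span_tmul_hwVector l _ fun v => by simp [LinearMap.mem_eqLocus, hΦ, hΨ]

end Frobenius

/-! ### The algebra of the F_i and its universal property -/

section NegativePart

variable {ι M N : Type*} [AddCommGroup M] [Module ℂ M] [AddCommGroup N] [Module ℂ N]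
  {P : RootPairing ι ℂ M N} [P.IsCrystallographic]
  (B : P.RootPositiveForm ℝ) (b : P.Base) (h : ℝˣ)

/-- The quantum Serre relations in the free algebra on the `F_i`. -/
inductive NMinusRel : FreeAlgebra ℂ b.support → FreeAlgebra ℂ b.support → Prop
  | serre (i j : b.support) (hij : i ≠ j) : NMinusRel
      (qSerre (qRoot B b h i) (serreExp b i j) (FreeAlgebra.ι ℂ i) (FreeAlgebra.ι ℂ j)) 0

/-- The algebra generated by the `F_i` subject to the quantum Serre relations. -/
def NMinus : Type _ := RingQuot (NMinusRel B b h)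

instance : Ring (NMinus B b h) := inferInstanceAs (Ring (RingQuot (NMinusRel B b h)))

instance : Algebra ℂ (NMinus B b h) := inferInstanceAs (Algebra ℂ (RingQuot (NMinusRel B b h)))

namespace NMinus

/-- The projection from the free algebra. -/
def mk : FreeAlgebra ℂ b.support →ₐ[ℂ] NMinus B b h := RingQuot.mkAlgHom ℂ (NMinusRel B b h)

/-- The generator `F_i`. -/
def F (i : b.support) : NMinus B b h := mk B b h (FreeAlgebra.ι ℂ i)

variable {B b h}

lemma serre_F {i j : b.support} (hij : i ≠ j) :
    qSerre (qRoot B b h i) (serreExp b i j) (F B b h i) (F B b h j) = 0 := by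
  have : mk B b h _ = mk B b h _ := RingQuot.mkAlgHom_rel ℂ (NMinusRel.serre i j hij)
  rwa [map_qSerre, map_zero] at this

variable {A : Type*} [Ring A] [Algebra ℂ A]

/-- The universal property of `NMinus`. -/
def lift (f : b.support → A)
    (hf : ∀ i j, i ≠ j → qSerre (qRoot B b h i) (serreExp b i j) (f i) (f j) = 0) :
    NMinus B b h →ₐ[ℂ] A :=
  RingQuot.liftAlgHom ℂ ⟨FreeAlgebra.lift ℂ f, fun x y hxy => by
    cases hxy with
    | serre i j hij => simp [map_qSerre, hf i j hij]⟩

@[simp] lemma lift_F (f : b.support → A)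
    (hf : ∀ i j, i ≠ j → qSerre (qRoot B b h i) (serreExp b i j) (f i) (f j) = 0) (i : b.support) :
    lift f hf (F B b h i) = f i :=
  (RingQuot.liftAlgHom_mkAlgHom_apply ..).trans (by simp)

lemma induction {p : NMinus B b h → Prop} (h1 : p 1) (hadd : ∀ x y, p x → p y → p (x + y))
    (hsmul : ∀ (c : ℂ) x, p x → p (c • x)) (hF : ∀ i x, p x → p (F B b h i * x))
    (x : NMinus B b h) : p x := by
  -- In this form the claim is multiplicative in x, so words in the F_i can be absorbed one factor
  -- at a time.
  suffices H : ∀ x : NMinus B b h, ∀ y, p y → p (x * y) by simpa using H x 1 h1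
  intro x
  obtain ⟨x, rfl⟩ : ∃ z, mk B b h z = x := RingQuot.mkAlgHom_surjective ℂ _ x
  induction x using FreeAlgebra.induction with
  | grade0 c =>
    intro y hy
    rw [AlgHom.commutes, ← Algebra.smul_def]
    exact hsmul c y hy
  | grade1 i => exact fun y hy => hF i y hy
  | mul a a' ha ha' =>
    intro y hy
    rw [map_mul, mul_assoc]
    exact ha _ (ha' y hy)
  | add a a' ha ha' =>
    intro y hy
    rw [map_add, add_mul]
    exact hadd _ _ (ha y hy) (ha' y hy)

lemma end_ext {Y : Type*} [AddCommGroup Y] [Module ℂ Y] {f g : NMinus B b h →ₗ[ℂ] Y}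
    (h1 : f 1 = g 1) (hF : ∀ i x, f x = g x → f (F B b h i * x) = g (F B b h i * x)) : f = g :=
  LinearMap.ext <| induction h1 (fun x y hx hy => by rw [map_add, map_add, hx, hy])
    (fun c x hx => by rw [map_smul, map_smul, hx]) hF

variable (B b h) in
/-- The automorphism `F_j ↦ q ^ (-(m, α_j)) F_j` of `NMinus`. -/
def weightAut (m : weightLattice B b) : NMinus B b h →ₐ[ℂ] NMinus B b h :=
  lift (fun j => (qForm B h m (P.root j))⁻¹ • F B b h j)
    fun i j hij => by rw [qSerre_smul_smul, serre_F hij, smul_zero]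

@[simp] lemma weightAut_F (m : weightLattice B b) (j : b.support) :
    weightAut B b h m (F B b h j) = (qForm B h m (P.root j))⁻¹ • F B b h j := lift_F _ _ _

/-! ### A highest weight action of U_q(g) on `NMinus` -/

variable (l : QWeight B b h)

variable (B b h) in
/-- The operator of left multiplication by `F_i`. -/
def opF (i : b.support) : Module.End ℂ (NMinus B b h) := Algebra.lmul ℂ _ (F B b h i)

/-- The action of `K_m` on the Verma module of highest weight `l`, realized on `NMinus`. -/
def opK (m : weightLattice B b) : Module.End ℂ (NMinus B b h) :=
  l.eval B b h m • (weightAut B b h m).toLinearMap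

@[simp] lemma opF_apply (i : b.support) (x : NMinus B b h) : opF B b h i x = F B b h i * x := rfl

lemma opK_apply (m : weightLattice B b) (x : NMinus B b h) :
    opK l m x = l.eval B b h m • weightAut B b h m x := rfl

lemma opK_one (m : weightLattice B b) : opK l m 1 = l.eval B b h m • 1 := by simp [opK_apply]

lemma opK_opF (m : weightLattice B b) (j : b.support) :
    opK l m * opF B b h j = (qForm B h m (P.root j))⁻¹ • (opF B b h j * opK l m) := by
  ext x
  simp [opK_apply, smul_comm (l.eval B b h m)]

lemma eval_zero : l.eval B b h 0 = 1 := by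
  induction l using QuotientAddGroup.induction_on with
  | H x => simp [QWeight.eval, qForm]

lemma eval_add (m m' : weightLattice B b) :
    l.eval B b h (m + m') = l.eval B b h m * l.eval B b h m' := by
  induction l using QuotientAddGroup.induction_on with
  | H x => simp [QWeight.eval, qForm, mul_add, Complex.exp_add]

lemma qForm_add_left (x y z : M) : qForm B h (x + y) z = qForm B h x z * qForm B h y z := by
  simp [qForm, mul_add, Complex.exp_add]

lemma opK_zero : opK l 0 = 1 := by
  refine end_ext (by simp [opK_one, eval_zero]) fun i x hx => ?_
  have := DFunLike.congr_fun (opK_opF l 0 i) x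
  simp only [Module.End.mul_apply, opF_apply, LinearMap.smul_apply] at this
  rw [this, hx]
  simp [qForm]

lemma opK_mul (m m' : weightLattice B b) : opK l m * opK l m' = opK l (m + m') := by
  refine end_ext ?_ fun i x hx => ?_
  · rw [Module.End.mul_apply, opK_one, map_smul, opK_one, opK_one, eval_add, smul_smul, mul_comm]
  · have key := fun m x => DFunLike.congr_fun (opK_opF l m i) x
    simp only [Module.End.mul_apply, opF_apply, LinearMap.smul_apply] at key hx ⊢
    rw [key, map_smul, key, hx, key, smul_smul, AddSubgroup.coe_add, qForm_add_left, mul_inv_rev]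

/-- The operator `[E_i, F_i] = (K_i - K_i⁻¹) / (q_i - q_i⁻¹)`. -/
def opH (i : b.support) : Module.End ℂ (NMinus B b h) :=
  (qRoot B b h i - (qRoot B b h i)⁻¹)⁻¹ • (opK l (simpleRoot B b i) - opK l (-simpleRoot B b i))

lemma opK_neg_opF (m : weightLattice B b) (j : b.support) :
    opK l (-m) * opF B b h j = qForm B h m (P.root j) • (opF B b h j * opK l (-m)) := by
  rw [opK_opF, AddSubgroup.coe_neg, qForm_neg_left, inv_inv]

open TrivSqZeroExt in
open Classical in
/-- The image of the generator `F_j` under the homomorphism to the dual numbers over the operators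
on `NMinus` that encodes the commutator with `E_i`. -/
def dualF (i j : b.support) : DualNumber (Module.End ℂ (NMinus B b h)) :=
  inl (opF B b h j) + inr (if j = i then opH l i else 0)

lemma qSerre_opF {i j : b.support} (hij : i ≠ j) :
    qSerre (qRoot B b h i) (serreExp b i j) (opF B b h i) (opF B b h j) = 0 := by
  rw [opF, opF, ← map_qSerre, serre_F hij, map_zero]

/-- Only F_n has a nonzero commutator with E_n, so at most one of the two arguments is deformed, and
`qSerre_dualNumber_left` or `qSerre_dualNumber_right` applies. -/
lemma qSerre_dualF [Finite ι] (n : b.support) {i j : b.support} (hij : i ≠ j) :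
    qSerre (qRoot B b h i) (serreExp b i j) (dualF l n i) (dualF l n j) = 0 := by
  obtain ⟨m, hm, hf⟩ := exists_serreExp B b h hij
  have hs := qSerre_opF (B := B) (h := h) hij
  have h0 := qRoot_ne_zero B b h i
  have hq := qInt_qRoot_ne_zero B b h i
  rw [hm] at hs ⊢
  have hf' := hf
  rw [qForm_symm] at hf'
  by_cases hi : i = n
  · subst hi
    have key := qSerre_dualNumber_left h0 hq (f := opF B b h i) (y := opF B b h j) (m := m)
      (k := opK l (simpleRoot B b i)) (k' := opK l (-simpleRoot B b i))
      (s := (qRoot B b h i - (qRoot B b h i)⁻¹)⁻¹)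
      (by rw [opK_opF]; simp [simpleRoot, qForm_self])
      (by rw [opK_neg_opF]; simp [simpleRoot, qForm_self])
      (by rw [opK_opF]; simp [simpleRoot, hf])
      (by rw [opK_neg_opF]; simp [simpleRoot, hf])
    rw [hs] at key
    simpa [dualF, hij.symm, opH] using key
  · by_cases hj : j = n
    · subst hj
      have key := qSerre_dualNumber_right h0 hq (f := opF B b h i) (y := opF B b h j) (m := m)
        (k := opK l (simpleRoot B b j)) (k' := opK l (-simpleRoot B b j))
        (s := (qRoot B b h j - (qRoot B b h j)⁻¹)⁻¹)
        (by rw [opK_opF]; simp [simpleRoot, hf'])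
        (by rw [opK_neg_opF]; simp [simpleRoot, hf'])
      rw [hs] at key
      simpa [dualF, hij, opH] using key
    · have := map_qSerre (TrivSqZeroExt.inlAlgHom ℂ _ (Module.End ℂ (NMinus B b h)))
        (qRoot B b h i) (m + 1) (opF B b h i) (opF B b h j)
      rw [hs, map_zero] at this
      simpa [dualF, hi, hj] using this.symm

/-- The homomorphism `x ↦ x + ε [E_i, x]` from `NMinus` to the dual numbers over the operators
on `NMinus`. -/
def dualHom [Finite ι] (i : b.support) :
    NMinus B b h →ₐ[ℂ] DualNumber (Module.End ℂ (NMinus B b h)) :=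
  lift (dualF l i) fun _ _ => qSerre_dualF l i

lemma fst_dualHom [Finite ι] (i : b.support) (x : NMinus B b h) :
    (dualHom l i x).fst = Algebra.lmul ℂ _ x := by
  induction x using NMinus.induction with
  | h1 => rw [map_one, map_one, TrivSqZeroExt.fst_one]
  | hadd x y hx hy => simp [hx, hy]
  | hsmul c x hx => simp [hx]
  | hF j x hx =>
    rw [map_mul, TrivSqZeroExt.fst_mul, hx, map_mul, dualHom, lift_F, dualF, TrivSqZeroExt.fst_add,
      TrivSqZeroExt.fst_inl, TrivSqZeroExt.fst_inr, add_zero, opF]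

/-- The action of `E_i` on the Verma module of highest weight `l`, realized on `NMinus`. -/
def opE [Finite ι] (i : b.support) : Module.End ℂ (NMinus B b h) where
  -- The vector 1 must be killed by E_i, so E_i x = [E_i, x] · 1.
  toFun x := (dualHom l i x).snd 1
  map_add' x y := by simp
  map_smul' c x := by simp

lemma opE_apply [Finite ι] (i : b.support) (x : NMinus B b h) :
    opE l i x = (dualHom l i x).snd 1 := rfl

@[simp] lemma opE_one [Finite ι] (i : b.support) : opE l i 1 = 0 := by simp [opE_apply]

-- This is the product rule [E_i, F_j x] = F_j [E_i, x] + [E_i, F_j] x, read off from multiplication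
-- of dual numbers and evaluated at 1.
open Classical in
lemma opE_opF [Finite ι] (i j : b.support) :
    opE l i * opF B b h j - opF B b h j * opE l i = if j = i then opH l i else 0 := by
  ext x
  simp only [LinearMap.sub_apply, Module.End.mul_apply, opF_apply, opE_apply, map_mul]
  have e : dualHom l i (F B b h j) = dualF l i j := lift_F _ _ _
  simp only [TrivSqZeroExt.snd_mul, fst_dualHom l i x, e, dualF, TrivSqZeroExt.fst_add,
    TrivSqZeroExt.snd_add, TrivSqZeroExt.fst_inl, TrivSqZeroExt.snd_inl, TrivSqZeroExt.fst_inr,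
    TrivSqZeroExt.snd_inr]
  split_ifs <;> simp

/-- Both sides kill 1, and `opE_opF` carries the identity from x to F_j x: the extra term H_i
commutes with K_m, and the scalars of E_i and F_i cancel. -/
lemma opK_opE [Finite ι] (m : weightLattice B b) (i : b.support) :
    opK l m * opE l i = qForm B h m (P.root i) • (opE l i * opK l m) := by
  classical
  refine end_ext (by simp [opK_one]) fun j x hx => ?_
  have h1 := fun x => DFunLike.congr_fun (sub_eq_iff_eq_add.mp (opE_opF l i j)) x
  have h2 := fun x => DFunLike.congr_fun (opK_opF l m j) x
  simp only [Module.End.mul_apply, opF_apply, LinearMap.smul_apply,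
    LinearMap.add_apply] at h1 h2 hx ⊢
  rw [h1, map_add, h2, hx, h2, map_smul, h1, mul_smul_comm, smul_comm (qForm B h m (P.root i)),
    smul_add, add_comm, add_comm (_ • _),
    smul_add]
  congr 1
  split_ifs with hji
  · subst hji
    have : ∀ m' : weightLattice B b, opK l m (opK l m' x) = opK l m' (opK l m x) := fun m' => by
      rw [← Module.End.mul_apply, ← Module.End.mul_apply, opK_mul, opK_mul, add_comm]
    rw [smul_smul, inv_mul_cancel₀ (qForm_ne_zero B h _ _), one_smul]
    simp [opH, this]
  · simp

/-- The Serre expression in the E's commutes with every F_n, by the dual number argument with E and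
F exchanged, and it kills 1. Since 1 generates `NMinus` under the F_n, it is zero. -/
lemma qSerre_opE [Finite ι] {i j : b.support} (hij : i ≠ j) :
    qSerre (qRoot B b h i) (serreExp b i j) (opE l i) (opE l j) = 0 := by
  classical
  obtain ⟨m, hm, hf⟩ := exists_serreExp B b h hij
  have h0 := qRoot_ne_zero B b h i
  have hq := qInt_qRoot_ne_zero B b h i
  rw [hm]
  have hf' := hf
  rw [qForm_symm] at hf'
  have hKneg : ∀ (m : weightLattice B b) (j : b.support),
    opK l (-m) * opE l j = (qForm B h m (P.root j))⁻¹ • (opE l j * opK l (-m)) := fun m j => by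
    rw [opK_opE, AddSubgroup.coe_neg, qForm_neg_left]
  have had : ∀ n j : b.support, adDualNumber (opF B b h n) (opE l j) =
      TrivSqZeroExt.inl (opE l j) + TrivSqZeroExt.inr (if n = j then
        (qRoot B b h j - (qRoot B b h j)⁻¹)⁻¹ •
          (opK l (-simpleRoot B b j) - opK l (simpleRoot B b j)) else 0) := fun n j => by
    rw [adDualNumber_apply, ← neg_sub, opE_opF, ← neg_sub (opK l (simpleRoot B b j)), smul_neg]
    split_ifs <;> simp [opH]
  have hcomm : ∀ n, opF B b h n * qSerre (qRoot B b h i) (m + 1) (opE l i) (opE l j) =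
      qSerre (qRoot B b h i) (m + 1) (opE l i) (opE l j) * opF B b h n := fun n => by
    refine commute_qSerre_of_adDualNumber ?_
    rw [had, had]
    by_cases hi : n = i
    · subst hi
      have key := qSerre_dualNumber_left h0 hq (f := opE l n) (y := opE l j) (m := m)
        (k := opK l (-simpleRoot B b n)) (k' := opK l (simpleRoot B b n))
        (s := (qRoot B b h n - (qRoot B b h n)⁻¹)⁻¹)
        (by rw [hKneg]; simp [simpleRoot, qForm_self])
        (by rw [opK_opE]; simp [simpleRoot, qForm_self])
        (by rw [hKneg]; simp [simpleRoot, hf])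
        (by rw [opK_opE]; simp [simpleRoot, hf])
      simpa [hij] using key
    · by_cases hj : n = j
      · subst hj
        have key := qSerre_dualNumber_right h0 hq (f := opE l i) (y := opE l n) (m := m)
          (k := opK l (-simpleRoot B b n)) (k' := opK l (simpleRoot B b n))
          (s := (qRoot B b h n - (qRoot B b h n)⁻¹)⁻¹)
          (by rw [hKneg]; simp [simpleRoot, hf'])
          (by rw [opK_opE]; simp [simpleRoot, hf'])
        simpa [hi] using key
      · have := map_qSerre (TrivSqZeroExt.inlAlgHom ℂ _ (Module.End ℂ (NMinus B b h)))
          (qRoot B b h i) (m + 1) (opE l i) (opE l j)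
        simpa [hi, hj] using this.symm
  refine end_ext ?_ fun n x hx => ?_
  -- The rightmost factor of each summand is E_j for k = 0 and E_i otherwise; both kill 1.
  · have hp : ∀ (i : b.support) (k : ℕ), k ≠ 0 → (opE l i ^ k) 1 = 0 := fun i k hk => by
      obtain ⟨k, rfl⟩ := Nat.exists_eq_succ_of_ne_zero hk
      simp [pow_succ]
    simp only [qSerre, LinearMap.sum_apply, LinearMap.smul_apply, Module.End.mul_apply,
      LinearMap.zero_apply]
    refine Finset.sum_eq_zero fun k _ => ?_
    rcases eq_or_ne k 0 with rfl | hk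
    · simp
    · simp [hp i k hk]
  · have := DFunLike.congr_fun (hcomm n) x
    simp only [Module.End.mul_apply, opF_apply] at this
    rw [← this, hx]
    simp

lemma satisfiesRel [Finite ι] : SatisfiesRel B b h (opK l) (opE l) (opF B b h) := by
  classical
  exact {
    k_zero := opK_zero l
    k_mul := opK_mul l
    k_e := opK_opE l
    k_f := opK_opF l
    e_f_self := fun i => by rw [opE_opF, if_pos rfl]; rfl
    e_f_ne := fun i j hij => by rw [opE_opF, if_neg hij.symm]
    serre_e := fun i j => qSerre_opE l
    serre_f := fun i j => qSerre_opF }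

/-- The comparison map from a Verma module to `NMinus`. -/
lemma exists_verma_map [Finite ι] : ∃ g : Verma B b h l →ₗ[ℂ] NMinus B b h,
    g (Verma.hwVector B b h l) = 1 ∧ ∀ i v, g (Uq.F B b h i • v) = F B b h i * g v := by
  obtain ⟨g, hg, hg'⟩ := Verma.exists_lift (l := l) (satisfiesRel l).lift 1 (by simp)
    (fun m => by rw [SatisfiesRel.lift_K, opK_one])
  exact ⟨g, hg, fun i v => by rw [hg', SatisfiesRel.lift_F, opF_apply]⟩

end NMinus

end NegativePart

/-! ### Rescaling automorphisms on Verma and simple modules -/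

section Twist

variable {ι M N : Type*} [AddCommGroup M] [Module ℂ M] [AddCommGroup N] [Module ℂ N]
  {P : RootPairing ι ℂ M N} [P.IsCrystallographic]
  {B : P.RootPositiveForm ℝ} {b : P.Base} {h : ℝˣ}

/-- A rescaling automorphism of `U_q(𝔤)` preserves the ideal defining a Verma module. -/
lemma vermaIdeal_scale (l : QWeight B b h) {c : b.support → ℂ} (hc : ∀ i, c i ≠ 0) {x : Uq B b h}
    (hx : x ∈ vermaIdeal B b h l) : Uq.scale B h hc x ∈ vermaIdeal B b h l := by
  induction hx using Submodule.span_induction with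
  | mem x hx =>
    rcases hx with ⟨i, rfl⟩ | ⟨m, rfl⟩
    · rw [Uq.scale, SatisfiesRel.lift_E, ← algebraMap_smul (Uq B b h)]
      exact Submodule.smul_mem _ _ (Submodule.subset_span (Or.inl ⟨i, rfl⟩))
    · rw [map_sub, AlgHom.commutes, Uq.scale, SatisfiesRel.lift_K]
      exact Submodule.subset_span (Or.inr ⟨m, rfl⟩)
  | zero => rw [map_zero]; exact Submodule.zero_mem _
  | add x y _ _ hx hy => rw [map_add]; exact Submodule.add_mem _ hx hy
  | smul a x _ hx => rw [smul_eq_mul, map_mul]; exact Submodule.smul_mem _ _ hx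

/-- The semilinear endomorphism of a Verma module induced by a rescaling automorphism. -/
def Verma.twist (l : QWeight B b h) {c : b.support → ℂ} (hc : ∀ i, c i ≠ 0) :
    Verma B b h l →ₛₗ[(Uq.scale B h hc).toRingHom] Verma B b h l :=
  (vermaIdeal B b h l).mapQ _
    { toFun := Uq.scale B h hc
      map_add' := map_add _
      map_smul' := map_mul _ }
    fun _ hx => vermaIdeal_scale l hc hx

lemma Verma.twist_mk (l : QWeight B b h) {c : b.support → ℂ} (hc : ∀ i, c i ≠ 0) (x : Uq B b h) :
    Verma.twist l hc (Submodule.Quotient.mk x) = Submodule.Quotient.mk (Uq.scale B h hc x) := rfl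

lemma Verma.twist_hwVector (l : QWeight B b h) {c : b.support → ℂ} (hc : ∀ i, c i ≠ 0) :
    Verma.twist l hc (Verma.hwVector B b h l) = Verma.hwVector B b h l := by
  rw [Verma.hwVector, twist_mk, map_one]

lemma Verma.twist_twist (l : QWeight B b h) {c d : b.support → ℂ} (hc : ∀ i, c i ≠ 0)
    (hd : ∀ i, d i ≠ 0) (hcd : ∀ i, c i * d i = 1) (v : Verma B b h l) :
    Verma.twist l hc (Verma.twist l hd v) = v := by
  obtain ⟨x, rfl⟩ := Submodule.Quotient.mk_surjective _ v
  rw [twist_mk, twist_mk, Uq.scale_scale B b h hc hd hcd]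

/-- Twists fix the highest weight vector, so pulling back along the inverse twist preserves the
family of submodules that avoid it. -/
lemma Verma.twist_mem_maxSubmodule (l : QWeight B b h) {c : b.support → ℂ} (hc : ∀ i, c i ≠ 0)
    {v : Verma B b h l} (hv : v ∈ Verma.maxSubmodule B b h l) :
    Verma.twist l hc v ∈ Verma.maxSubmodule B b h l := by
  have hc' : ∀ i, (c i)⁻¹ ≠ 0 := fun i => inv_ne_zero (hc i)
  suffices H : Verma.maxSubmodule B b h l ≤
      (Verma.maxSubmodule B b h l).comap (Verma.twist l hc) from H hv
  refine sSup_le fun W hW w hw => ?_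
  have hW' : W.comap (Verma.twist l hc') ≤ Verma.maxSubmodule B b h l := le_sSup (by
    change Verma.hwVector B b h l ∉ W.comap (Verma.twist l hc')
    rwa [Submodule.mem_comap, Verma.twist_hwVector])
  refine hW' ?_
  rwa [Submodule.mem_comap, Verma.twist_twist l hc' hc fun i => inv_mul_cancel₀ (hc i)]

/-- The semilinear endomorphism of a simple highest weight module induced by a rescaling
automorphism. -/
def SimpleHW.twist (l : QWeight B b h) {c : b.support → ℂ} (hc : ∀ i, c i ≠ 0) :
    SimpleHW B b h l →ₛₗ[(Uq.scale B h hc).toRingHom] SimpleHW B b h l :=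
  (Verma.maxSubmodule B b h l).mapQ _ (Verma.twist l hc)
    fun _ hx => Verma.twist_mem_maxSubmodule l hc hx

lemma SimpleHW.twist_twist (l : QWeight B b h) {c d : b.support → ℂ} (hc : ∀ i, c i ≠ 0)
    (hd : ∀ i, d i ≠ 0) (hcd : ∀ i, c i * d i = 1) (v : SimpleHW B b h l) :
    SimpleHW.twist l hc (SimpleHW.twist l hd v) = v := by
  obtain ⟨x, rfl⟩ := Submodule.Quotient.mk_surjective _ v
  exact congrArg Submodule.Quotient.mk (Verma.twist_twist l hc hd hcd x)

lemma SimpleHW.twist_smul (l : QWeight B b h) {c : b.support → ℂ} (hc : ∀ i, c i ≠ 0)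
    (x : Uq B b h) (v : SimpleHW B b h l) :
    SimpleHW.twist l hc (x • v) = Uq.scale B h hc x • SimpleHW.twist l hc v :=
  LinearMap.map_smulₛₗ _ x v

/-- D multiplies F_{i_1} ⋯ F_{i_r} v by (c_{i_1} ⋯ c_{i_r})⁻¹, where v is the highest weight vector.
Obtaining it from an automorphism of U_q(g) makes it well defined without any weight decomposition.
-/
lemma SimpleHW.exists_twist (l : QWeight B b h) {c : b.support → ℂ} (hc : ∀ i, c i ≠ 0) :
    ∃ D : SimpleHW B b h l ≃ₗ[ℂ] SimpleHW B b h l,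
      (∀ i v, D (Uq.E B b h i • v) = c i • Uq.E B b h i • D v) ∧
        ∀ m v, D (Uq.K B b h m • v) = Uq.K B b h m • D v := by
  have hc' : ∀ i, (c i)⁻¹ ≠ 0 := fun i => inv_ne_zero (hc i)
  refine ⟨{
    toFun := SimpleHW.twist l hc
    invFun := SimpleHW.twist l hc'
    map_add' := map_add _
    map_smul' := fun a v => by
      rw [← algebraMap_smul (Uq B b h) a v, SimpleHW.twist_smul, AlgHom.commutes, algebraMap_smul]
      rfl
    left_inv := SimpleHW.twist_twist l hc' hc fun i => inv_mul_cancel₀ (hc i)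
    right_inv := SimpleHW.twist_twist l hc hc' fun i => mul_inv_cancel₀ (hc i) }, ?_, ?_⟩
  · intro i v
    refine (SimpleHW.twist_smul l hc _ v).trans ?_
    have e : Uq.scale B h hc (Uq.E B b h i) = c i • Uq.E B b h i := SatisfiesRel.lift_E _ i
    rw [e, smul_assoc]
    rfl
  · intro m v
    refine (SimpleHW.twist_smul l hc _ v).trans ?_
    have e : Uq.scale B h hc (Uq.K B b h m) = Uq.K B b h m := SatisfiesRel.lift_K _ m
    rw [e]
    rfl

lemma QWeight.eval_ne_zero (l : QWeight B b h) (m : weightLattice B b) : l.eval B b h m ≠ 0 := by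
  induction l using QuotientAddGroup.induction_on with
  | H x => exact qForm_ne_zero B h x m

end Twist

/-! ### Coinvariants under the F_i and category O -/

section Coinvariants

variable {ι M N : Type*} [AddCommGroup M] [Module ℂ M] [AddCommGroup N] [Module ℂ N]
  {P : RootPairing ι ℂ M N} [P.IsCrystallographic]
  {B : P.RootPositiveForm ℝ} {b : P.Base} {h : ℝˣ}
  {W : Type*} [AddCommGroup W] [Module ℂ W] [Module (Uq B b h) W] [IsScalarTower ℂ (Uq B b h) W]

lemma Uq.E_smul_F_smul (i j : b.support) (w : W) : ∃ c : ℂ,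
    Uq.E B b h i • Uq.F B b h j • w = Uq.F B b h j • Uq.E B b h i • w +
      c • (Uq.K B b h (simpleRoot B b i) • w - Uq.K B b h (-simpleRoot B b i) • w) := by
  rcases eq_or_ne i j with rfl | hij
  · refine ⟨(qRoot B b h i - (qRoot B b h i)⁻¹)⁻¹, ?_⟩
    rw [← mul_smul, sub_eq_iff_eq_add'.mp (Uq.E_F_self (B := B) (h := h) i), add_smul,
      mul_smul, smul_assoc, sub_smul]
  · refine ⟨0, ?_⟩
    rw [← mul_smul, sub_eq_zero.mp (Uq.E_F_ne hij), mul_smul, zero_smul, add_zero]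

/-- Conjugation by K_m rescales each E_i. Consequently U_q(n_+) v is stable under the K_m when v is
a weight vector. -/
lemma Uq.conj_K_mem_nPlus (m : weightLattice B b) {x : Uq B b h} (hx : x ∈ Uq.nPlus B b h) :
    Uq.K B b h m * x * Uq.K B b h (-m) ∈ Uq.nPlus B b h := by
  induction hx using Algebra.adjoin_induction with
  | mem x hx =>
    obtain ⟨i, rfl⟩ := hx
    rw [Uq.K_E]
    exact Subalgebra.smul_mem _ (Algebra.subset_adjoin (Set.mem_range_self i)) _
  | algebraMap c =>
    rw [← Algebra.commutes, mul_assoc, Uq.K_mul_neg, mul_one]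
    exact Subalgebra.algebraMap_mem _ c
  | add x y _ _ hx hy => rw [mul_add, add_mul]; exact add_mem hx hy
  | mul x y _ _ hx hy =>
    have : Uq.K B b h m * (x * y) * Uq.K B b h (-m) =
        (Uq.K B b h m * x * Uq.K B b h (-m)) * (Uq.K B b h m * y * Uq.K B b h (-m)) := by
      rw [mul_assoc (Uq.K B b h m * x), ← mul_assoc (Uq.K B b h (-m)),
        ← mul_assoc (Uq.K B b h (-m)),
        Uq.K_neg_mul, one_mul]
      simp only [mul_assoc]
    rw [this]
    exact mul_mem hx hy

lemma mem_nPlusOrbit {v w : W} :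
    w ∈ nPlusOrbit B b h v ↔ ∃ x ∈ Uq.nPlus B b h, x • v = w := by
  simp [nPlusOrbit]

/-- In a module of category `𝒪`, every vector lies in a finite-dimensional subspace that is stable
under all `K_m` and all `E_i`. -/
lemma InCategoryO.exists_finiteDimensional_mem (hW : InCategoryO B b h W) (w : W) :
    ∃ G : Submodule ℂ W, FiniteDimensional ℂ G ∧ w ∈ G ∧
      (∀ m, ∀ v ∈ G, Uq.K B b h m • v ∈ G) ∧ ∀ i, ∀ v ∈ G, Uq.E B b h i • v ∈ G := by
  have htop : w ∈ ⨆ l : QWeight B b h, weightSpace B b h W l := by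
    classical
    rw [DirectSum.IsInternal.submodule_iSup_eq_top (by convert hW.isInternal_weightSpace)]
    trivial
  -- U_q(n_+) v serves for a weight vector v; for a sum of weight vectors one adds the corresponding
  -- subspaces.
  induction htop using Submodule.iSup_induction' with
  | mem l v hv =>
    refine ⟨nPlusOrbit B b h v, hW.finiteDimensional_nPlusOrbit v,
      mem_nPlusOrbit.mpr ⟨1, one_mem _, one_smul _ v⟩, fun m u hu => ?_, fun i u hu => ?_⟩
    · obtain ⟨x, hx, rfl⟩ := mem_nPlusOrbit.mp hu
      have : Uq.K B b h m • x • v =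
          l.eval B b h m • (Uq.K B b h m * x * Uq.K B b h (-m)) • v := by
        rw [← smul_algebra_smul_comm, ← hv m, ← mul_smul, ← mul_smul,
          mul_assoc _ (Uq.K B b h (-m)), Uq.K_neg_mul,
          mul_one]
      rw [this]
      exact Submodule.smul_mem _ _ (mem_nPlusOrbit.mpr ⟨_, Uq.conj_K_mem_nPlus m hx, rfl⟩)
    · obtain ⟨x, hx, rfl⟩ := mem_nPlusOrbit.mp hu
      exact mem_nPlusOrbit.mpr
        ⟨_, mul_mem (Algebra.subset_adjoin ⟨i, rfl⟩) hx, mul_smul _ x v⟩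
  | zero =>
    exact ⟨⊥, inferInstance, Submodule.zero_mem _, fun m v hv => by simp_all,
      fun i v hv => by simp_all⟩
  | add u v _ _ hu hv =>
    obtain ⟨G, h1, h2, h3, h4⟩ := hu
    obtain ⟨G', h1', h2', h3', h4'⟩ := hv
    refine ⟨G ⊔ G', inferInstance, Submodule.add_mem_sup h2 h2', fun m w hw => ?_, fun i w hw => ?_⟩
    · obtain ⟨x, hx, y, hy, rfl⟩ := Submodule.mem_sup.mp hw
      rw [smul_add]
      exact Submodule.add_mem_sup (h3 m x hx) (h3' m y hy)
    · obtain ⟨x, hx, y, hy, rfl⟩ := Submodule.mem_sup.mp hw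
      rw [smul_add]
      exact Submodule.add_mem_sup (h4 i x hx) (h4' i y hy)

/-- A module of category `𝒪` is generated by a finite-dimensional subspace that is stable under all
`K_m` and all `E_i`. -/
lemma InCategoryO.exists_finiteDimensional_generating (hW : InCategoryO B b h W) :
    ∃ G : Submodule ℂ W, FiniteDimensional ℂ G ∧ Submodule.span (Uq B b h) (G : Set W) = ⊤ ∧
      (∀ m, ∀ v ∈ G, Uq.K B b h m • v ∈ G) ∧ ∀ i, ∀ v ∈ G, Uq.E B b h i • v ∈ G := by
  obtain ⟨S, hS⟩ := hW.finite.fg_top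
  choose G h1 h2 h3 h4 using hW.exists_finiteDimensional_mem
  have hstab : ∀ x : Uq B b h, (∀ w, ∀ v ∈ G w, x • v ∈ G w) →
      ∀ v ∈ ⨆ w : S, G w, x • v ∈ ⨆ w : S, G w := fun x hx v hv => by
    induction hv using Submodule.iSup_induction' with
    | mem w v hv => exact Submodule.mem_iSup_of_mem w (hx w v hv)
    | zero => rw [smul_zero]; exact Submodule.zero_mem _
    | add u v _ _ hu hv => rw [smul_add]; exact Submodule.add_mem _ hu hv
  refine ⟨⨆ w : S, G w, inferInstance, ?_, fun m => hstab _ fun w => h3 w m,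
    fun i => hstab _ fun w => h4 w i⟩
  rw [eq_top_iff, ← hS]
  exact Submodule.span_mono fun w hw => Submodule.mem_iSup_of_mem (⟨w, hw⟩ : S) (h2 w)

/-- The spaces of `F`-coinvariants of modules of category `𝒪` are finite-dimensional. -/
lemma InCategoryO.finiteDimensional_of_coinvariants (hW : InCategoryO B b h W) {Z : Type*}
    [AddCommGroup Z] [Module ℂ Z] (ζ : W →ₗ[ℂ] Z) (hζ : Function.Surjective ζ)
    (hF : ∀ i w, ζ (Uq.F B b h i • w) = 0) : FiniteDimensional ℂ Z := by
  obtain ⟨G, hfin, hspan, hK, hE⟩ := hW.exists_finiteDimensional_generating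
  -- The infimum of 𝓡 is the span of G under the F_i. Its minimality replaces the triangular
  -- decomposition in showing that it is all of W.
  let 𝓡 : Set (Submodule ℂ W) := {R | G ≤ R ∧ ∀ i, ∀ w ∈ R, Uq.F B b h i • w ∈ R}
  have hmin : ∀ R ∈ 𝓡, sInf 𝓡 ≤ R := fun R hR => sInf_le hR
  have hmem : sInf 𝓡 ∈ 𝓡 := by
    refine ⟨le_sInf fun R hR => hR.1, fun i w hw => Submodule.mem_sInf.mpr fun R hR => ?_⟩
    exact hR.2 i w (hmin R hR hw)
  have hRK : ∀ m, ∀ w ∈ sInf 𝓡, Uq.K B b h m • w ∈ sInf 𝓡 := fun m =>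
    hmin ((sInf 𝓡).comap (Algebra.lsmul ℂ ℂ W (Uq.K B b h m))) (by
      refine ⟨fun w hw => hmem.1 (hK m w hw), fun i w hw => ?_⟩
      change Uq.K B b h m • Uq.F B b h i • w ∈ sInf 𝓡
      rw [← mul_smul, Uq.K_mul_F, smul_assoc, mul_smul]
      exact Submodule.smul_mem _ _ (hmem.2 i _ hw))
  -- The intersection with the preimage is used because E_i F_j w involves both F_j E_i w and
  -- K_i^{±1} w, so w itself must stay in the infimum.
  have hRE : ∀ i, ∀ w ∈ sInf 𝓡, Uq.E B b h i • w ∈ sInf 𝓡 := fun i w hw =>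
    (hmin (sInf 𝓡 ⊓ (sInf 𝓡).comap (Algebra.lsmul ℂ ℂ W (Uq.E B b h i))) (by
      refine ⟨fun w hw => ⟨hmem.1 hw, hmem.1 (hE i w hw)⟩, fun j w hw => ⟨hmem.2 j w hw.1, ?_⟩⟩
      change Uq.E B b h i • Uq.F B b h j • w ∈ sInf 𝓡
      obtain ⟨c, hc⟩ := Uq.E_smul_F_smul (B := B) (h := h) i j w
      rw [hc]
      exact Submodule.add_mem _ (hmem.2 j _ hw.2)
        (Submodule.smul_mem _ _ (Submodule.sub_mem _ (hRK _ w hw.1) (hRK _ w hw.1)))) hw).2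
  have htop : Uq.submoduleOfGenerators (sInf 𝓡) hRK hRE hmem.2 = ⊤ := by
    rw [eq_top_iff, ← hspan, Submodule.span_le]
    exact hmem.1
  -- As ζ kills every F_i w, the preimage of ζ(G) is stable under the F_i, and it contains G.
  have hle : sInf 𝓡 ≤ (G.map ζ).comap ζ :=
    hmin _ ⟨Submodule.le_comap_map ζ G, fun i w _ => by
      rw [Submodule.mem_comap, hF]; exact Submodule.zero_mem _⟩
  have hZ : G.map ζ = ⊤ := by
    rw [eq_top_iff]
    rintro z -
    obtain ⟨w, rfl⟩ := hζ z
    have hw : w ∈ Uq.submoduleOfGenerators (sInf 𝓡) hRK hRE hmem.2 := htop ▸ Submodule.mem_top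
    exact hle hw
  have := Module.Finite.map G ζ
  rw [hZ] at this
  exact Module.finite_def.mpr (Module.Finite.iff_fg.mp this)

/-- The antihomomorphism `F_i ↦ -F_i K_i` from `NMinus` to the operators on a module. -/
lemma exists_antihom_nMinus [Finite ι] : ∃ σ : NMinus B b h →ₐ[ℂ] (Module.End ℂ W)ᵐᵒᵖ,
    ∀ i w, (σ (NMinus.F B b h i)).unop w =
      -(Uq.F B b h i • Uq.K B b h (simpleRoot B b i) • w) := by
  have hs : ∀ i j : b.support, i ≠ j →
      qSerre (qRoot B b h i) (serreExp b i j) (Uq.F B b h i) (Uq.F B b h j) = 0 :=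
    fun i j => Uq.serre_F
  refine ⟨((Algebra.lsmul ℂ ℂ W).op.comp (Uq.antipodeInv B b h)).comp (NMinus.lift _ hs),
    fun i w => ?_⟩
  simp

/-- If a module that is isomorphic to `V ⊗ M(l)` belongs to category `𝒪`, then `V` is
finite-dimensional. -/
lemma InCategoryO.finiteDimensional_of_equiv_tensor_verma [Finite ι] (hW : InCategoryO B b h W)
    {V : Type*} [AddCommGroup V] [Module ℂ V] [Module (Uq B b h) V] [IsScalarTower ℂ (Uq B b h) V]
    (l : QWeight B b h) (e : W ≃ₗ[Uq B b h] UqTensor B b h V (Verma B b h l)) :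
    FiniteDimensional ℂ V := by
  obtain ⟨σ, hσ⟩ := exists_antihom_nMinus (B := B) (b := b) (h := h) (W := V)
  obtain ⟨g, hg, hgF⟩ := NMinus.exists_verma_map l
  -- This is v ⊗ y v_l ↦ S⁻¹(y) v, with y extracted by `g`. It is onto since v ⊗ v_l ↦ v.
  let ζ : UqTensor B b h V (Verma B b h l) →ₗ[ℂ] V := UqTensor.lift
    (((MulOpposite.opLinearEquiv ℂ).symm.toLinearMap ∘ₗ σ.toLinearMap ∘ₗ g).flip)
  have hζ : ∀ v x, ζ (UqTensor.tmul v x) = (σ (g x)).unop v := fun v x => UqTensor.lift_tmul _ v x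
  have hζF : ∀ i t, ζ (Uq.F B b h i • t) = 0 := fun i t => by
    have : ζ ∘ₗ Algebra.lsmul ℂ ℂ _ (Uq.F B b h i) = 0 := UqTensor.ext fun v x => by
      simp only [LinearMap.comp_apply, Algebra.lsmul_coe, LinearMap.zero_apply]
      -- Since σ(F_i) K_i⁻¹ v = -F_i v, the summand K_i⁻¹ v ⊗ F_i x cancels F_i v ⊗ x.
      rw [UqTensor.F_smul, map_add, hζ, hζ, hgF, map_mul, MulOpposite.unop_mul,
        Module.End.mul_apply,
        hσ, Uq.K_smul_K_neg_smul, map_neg, add_neg_cancel]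
    exact DFunLike.congr_fun this t
  refine hW.finiteDimensional_of_coinvariants (ζ ∘ₗ e.toLinearMap.restrictScalars ℂ)
    (fun v => ⟨e.symm (UqTensor.tmul v (Verma.hwVector B b h l)), ?_⟩) fun i w => ?_
  · simp [hζ, hg]
  · simp [hζF]

theorem tensor_verma_of_infinite [Finite ι] {μ : QWeight B b h} (l : QWeight B b h)
    (hμ : ¬ FiniteDimensional ℂ (SimpleHW B b h μ)) :
    Nonempty (UqTensor B b h (SimpleHW B b h μ) (Verma B b h l) ≃ₗ[Uq B b h]
        UqTensor B b h (Verma B b h l) (SimpleHW B b h μ)) ∧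
      ¬ InCategoryO B b h (UqTensor B b h (SimpleHW B b h μ) (Verma B b h l)) ∧
      ¬ InCategoryO B b h (UqTensor B b h (Verma B b h l) (SimpleHW B b h μ)) := by
  obtain ⟨D, hE, hK⟩ := SimpleHW.exists_twist μ
    (c := fun i => l.eval B b h (simpleRoot B b i)) fun i => QWeight.eval_ne_zero l _
  obtain ⟨e⟩ := nonempty_tensor_verma_equiv l D hE hK
  exact ⟨⟨e⟩,
    fun H => hμ (H.finiteDimensional_of_equiv_tensor_verma l (LinearEquiv.refl _ _)),
    fun H => hμ (H.finiteDimensional_of_equiv_tensor_verma l e.symm)⟩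

end Coinvariants

end QuantumCatO

end

theorem mainTheorem3 {𝔤 : Type*} [LieRing 𝔤] [LieAlgebra ℂ 𝔤] [FiniteDimensional ℂ 𝔤]
    [LieAlgebra.IsSemisimple ℂ 𝔤] (𝔥 : LieSubalgebra ℂ 𝔤) [𝔥.IsCartanSubalgebra]
    (b : (LieAlgebra.IsKilling.rootSystem 𝔥).Base)
    (B : (LieAlgebra.IsKilling.rootSystem 𝔥).RootPositiveForm ℝ)
    (h : ℝˣ) (μ l : QuantumCatO.QWeight B b h)
    (hμ : ¬ FiniteDimensional ℂ (QuantumCatO.SimpleHW B b h μ)) :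
    Nonempty (QuantumCatO.UqTensor B b h (QuantumCatO.SimpleHW B b h μ) (QuantumCatO.Verma B b h l)
      ≃ₗ[QuantumCatO.Uq B b h]
        QuantumCatO.UqTensor B b h (QuantumCatO.Verma B b h l) (QuantumCatO.SimpleHW B b h μ)) ∧
    ¬ QuantumCatO.InCategoryO B b h
      (QuantumCatO.UqTensor B b h (QuantumCatO.SimpleHW B b h μ) (QuantumCatO.Verma B b h l)) ∧
    ¬ QuantumCatO.InCategoryO B b h
      (QuantumCatO.UqTensor B b h (QuantumCatO.Verma B b h l) (QuantumCatO.SimpleHW B b h μ)) := by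
  exact QuantumCatO.tensor_verma_of_infinite l hμ
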